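/- A \emph{generalized non-crossing tree} (GNC-tree) with $n+1$ vertices is a tree whose vertices are $n+1$ points on a circle, listed in counterclockwise order as $v_0,v_1,\dots,v_n$, whose edges, drawn as chords, do not cross, and whose vertices carry positive integer labels $\ell(v_0)\le \ell(v_1)\le\dots\le \ell(v_n)$ such that whenever $j\ge 1$ is a label, every integer $i$ with $1\le i\le j$ is also a label. The root is $v_0$ (the first vertex labelled $1$). An edge $(v,w)$, where $v$ lies on the path from the root to $w$, is encoded by $u$ (ascent) if $\ell(v)<\ell(w)$, by $h$ (level) if $\ell(v)=\ell(w)$, and by $d$ (descent) if $\ell(v)>\ell(w)$; thus every path starting at the root is encoded by a word on $\{u,h,d\}$. A GNC-tree avoids a word $\sigma$ if no word of a path starting at the root has $\sigma$ as a contiguous subword. For a set $P$ of words let $\mathsf{GNC}_n(P)$ be the set of GNC-trees with $n+1$ vertices that avoid all words in $P$, and let $C_m=\frac{1}{m+1}\binom{2m}{m}$ be the Catalan numbers. \textbf{Theorem.} For every integer $n\ge 0$, the set $\mathsf{GNC}_{n+2}(uu,h)$ of $\{uu,h\}$-avoiding GNC-trees with $n+3$ vertices and the set $\mathsf{GNC}_n(dd,h)$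 of $\{dd,h\}$-avoiding GNC-trees with $n+1$ vertices are counted respectively by $$|\mathsf{GNC}_{n+2}(uu,h)|=\sum_{i=0}^n\binom{n}{i}2^{i+2}C_{i+1},\qquad |\mathsf{GNC}_n(dd,h)|=\sum_{j=0}^n(-1)^j\binom{2n-j}{j}3^j4^{n-j}C_{n-j}.$$ -/

import Mathlib

namespace GNC

/-- The three kinds of edges, seen from the root: ascents `u`, levels `h`, descents `d`. -/
inductive Step where
  | u
  | h
  | d
  deriving DecidableEq

/-- The code of an edge from a vertex with label `i` to a vertex with label `j`. -/
def stepOf (i j : ℕ) : Step :=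
  if i < j then Step.u else if i = j then Step.h else Step.d

/-- A graph whose vertices are `m` points placed in this (counterclockwise) order on a circle, its
edges being drawn as chords, is non-crossing if no two of its chords cross. -/
def NonCrossing {m : ℕ} (G : SimpleGraph (Fin m)) : Prop :=
  ∀ a b c d : Fin m, a < b → b < c → c < d → ¬ (G.Adj a c ∧ G.Adj b d)

/-- A rooted generalized non-crossing tree with `n + 1` vertices: a non-crossing tree whose vertices
carry positive integer labels that are weakly increasing in counterclockwise order and
form an initial segment of the positive integers. The vertices are numbered counterclockwise
from the root, which is the first vertex labelled `1`. -/
@[ext]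
structure Tree (n : ℕ) where
  graph : SimpleGraph (Fin (n + 1))
  isTree : graph.IsTree
  nonCrossing : NonCrossing graph
  label : Fin (n + 1) → ℕ
  label_pos : ∀ v, 1 ≤ label v
  label_mono : Monotone label
  label_initial : ∀ v, ∀ i, 1 ≤ i → i ≤ label v → ∃ w, label w = i

namespace Tree

variable {n : ℕ}

/-- The root is the first vertex. -/
def root (_T : Tree n) : Fin (n + 1) := 0

/-- The root has label `1`. -/
theorem label_root (T : Tree n) : T.label T.root = 1 := by
  obtain ⟨w, hw⟩ := T.label_initial T.root 1 le_rfl (T.label_pos _)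
  have h1 : T.label T.root ≤ T.label w := T.label_mono (Fin.zero_le w)
  have h2 := T.label_pos T.root
  omega

/-- The word on `{u, h, d}` that encodes a walk, read along the walk. -/
def word (T : Tree n) {v w : Fin (n + 1)} (p : T.graph.Walk v w) : List Step :=
  p.darts.map fun e => stepOf (T.label e.fst) (T.label e.snd)

/-- `T` contains the pattern `σ` if the word of some path that starts at the root has `σ` as a
contiguous subword. -/
def Contains (T : Tree n) (σ : List Step) : Prop :=
  ∃ (v : Fin (n + 1)) (p : T.graph.Walk T.root v), p.IsPath ∧ σ <:+: T.word p

theorem label_le (T : Tree n) (v : Fin (n + 1)) : T.label v ≤ n + 1 := by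
  have h : Finset.Icc 1 (T.label v) ⊆ Finset.univ.image T.label := by
    intro i hi
    rw [Finset.mem_Icc] at hi
    obtain ⟨w, hw⟩ := T.label_initial v i hi.1 hi.2
    exact Finset.mem_image.2 ⟨w, Finset.mem_univ w, hw⟩
  have h1 := (Finset.card_le_card h).trans Finset.card_image_le
  simpa using h1

/-- There are finitely many generalized non-crossing trees of a given size, so that `Set.ncard`
counts any set of them. -/
instance : Finite (Tree n) := by
  refine Finite.of_injective
    (fun T : Tree n => (T.graph, fun v => (⟨T.label v, Nat.lt_succ_of_le (T.label_le v)⟩ :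
      Fin (n + 2)))) ?_
  intro S T h
  rw [Prod.mk.injEq] at h
  refine Tree.ext h.1 (funext fun v => ?_)
  exact congrArg Fin.val (congrFun h.2 v)

end Tree

/-- The set of rooted generalized non-crossing trees with `n + 1` vertices that avoid all the
patterns in `P`. -/
def Avoiding (n : ℕ) (P : Set (List Step)) : Set (Tree n) :=
  {T | ∀ σ ∈ P, ¬ T.Contains σ}

end GNC

/-! Avoiding `h` makes the labels of adjacent vertices differ, so an edge is an ascent or a descent
according to the positions of its ends. The labels then matter only through the set of gaps at which
they increase, subject to one condition: every edge covers such a gap. This turns the trees into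
codes (`isCode_code`, `exists_code_eq`, `code_injective`).

Let the root a be the first vertex and c its last child. The descendants of c, together with c, fill
an interval from m + 1 to b, and the code falls apart into trees on [a, m], [m + 1, c] and [c, b]
rooted at a, c and c. The gap m lies under the edge ac and under no other. If m = a and c = m + 1 it
is the only gap under ac and must be taken; otherwise one of the first two parts is nontrivial and
supplies a gap, so m is free. Hence the weight 1 or 2 in `ncard_split`. Avoiding dd means avoiding
it in each part; avoiding uu also forces c = b, because c is reached by an ascent. Reflection
exchanges uu and dd and moves the root of the middle part to the front.

With F and L the generating functions of the uu- and dd-avoiding codes by number of edges, this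
gives F = 1 + X(2FL - 1) and L = 1 + X(2FL - 1)L. Hence FL = 2L - 1, L = 1 - 3XL + 4XL², and G = F -
1 satisfies G = X + 3XG + G². Both quadratics are solved by the Catalan series composed with a
rational function, whose coefficients are the stated sums. -/

namespace GNC

/-! ### Codes and their splitting at the last child of the root -/

/-- A parent function on the integers together with a set of gaps, the gap `g` lying between
`g` and `g + 1`. -/
abbrev Code := (ℤ → ℤ) × Set ℤ

/-- `x` encodes a non-crossing tree on the interval from `a` to `b` with root `r`: `x.1` maps a vertex
to its parent (and fixes the root and everything outside of the interval), and `x.2` is a set of gaps,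
at least one of which is covered by every edge. -/
structure IsCode (a b r : ℤ) (x : Code) : Prop where
  fix : ∀ v, v < a ∨ b < v → x.1 v = v
  root : x.1 r = r
  maps : ∀ v, a ≤ v → v ≤ b → a ≤ x.1 v ∧ x.1 v ≤ b
  reach : ∀ S : Set ℤ, r ∈ S → (∀ v, x.1 v ∈ S → v ∈ S) → ∀ v, a ≤ v → v ≤ b → v ∈ S
  cross : ∀ s t u v, s < t → t < u → u < v → (x.1 s = u ∨ x.1 u = s) →
    (x.1 t = v ∨ x.1 v = t) → False
  gaps : ∀ g ∈ x.2, a ≤ g ∧ g < b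
  up : ∀ v, v < x.1 v → ∃ g ∈ x.2, v ≤ g ∧ g < x.1 v
  down : ∀ v, x.1 v < v → ∃ g ∈ x.2, x.1 v ≤ g ∧ g < v

/-- The part of a code on the interval from `lo` to `hi`, with root `lo`. -/
noncomputable def resF (lo hi : ℤ) (x : Code) : Code :=
  (fun v => if lo < v ∧ v ≤ hi then x.1 v else v, {g | g ∈ x.2 ∧ lo ≤ g ∧ g < hi})

/-- The part of a code on the interval from `lo` to `hi`, with root `hi`. -/
noncomputable def resL (lo hi : ℤ) (x : Code) : Code :=
  (fun v => if lo ≤ v ∧ v < hi then x.1 v else v, {g | g ∈ x.2 ∧ lo ≤ g ∧ g < hi})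

/-- The code of the tree in which the last child of the root `a` is `c`, composed of trees
on the intervals from `a` to `m`, from `m + 1` to `c`, and from `c` on. -/
noncomputable def glue (a m c : ℤ) (x y z : Code) (e : Prop) : Code :=
  (fun v => if v ≤ m then x.1 v else if v < c then y.1 v else if v = c then a else z.1 v,
    {g | g ∈ x.2 ∨ g ∈ y.2 ∨ g ∈ z.2 ∨ (g = m ∧ e)})

/-- The last child of the root `a` is `c`, and its descendants are the vertices beyond `m`. -/
structure Split (a b m c : ℤ) (x : Code) : Prop where
  le_m : a ≤ m
  m_lt : m < c
  le_b : c ≤ b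
  parent : x.1 c = a
  left : ∀ v, a ≤ v → v ≤ m → x.1 v ≤ m
  middle : ∀ v, m < v → v < c → m < x.1 v ∧ x.1 v ≤ c
  right : ∀ v, c < v → v ≤ b → c ≤ x.1 v

/-- By `right`, c is the largest child of a. If m < m', then `middle` for m and `left` for m' keep
the parents of vertices in (m, m'] inside (m, m'], so these never reach the root. -/
theorem Split.unique {a b m c m' c' : ℤ} {x : Code} (hx : IsCode a b a x)
    (h : Split a b m c x) (h' : Split a b m' c' x) : m = m' ∧ c = c' := by
  have key : ∀ {m c m' c' : ℤ}, Split a b m c x → Split a b m' c' x → c ≤ c' := by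
    intro m c m' c' h h'
    by_contra hc
    have := h'.right c (by omega) h.le_b
    rw [h.parent] at this
    have := h'.m_lt
    have := h'.le_m
    omega
  have hc : c = c' := le_antisymm (key h h') (key h' h)
  subst hc
  have key2 : ∀ {m m' : ℤ}, Split a b m c x → Split a b m' c x → m' ≤ m := by
    intro m m' h h'
    by_contra hm
    have h1 := h.le_m
    have h2 := h'.m_lt
    have h3 := h.le_b
    have := hx.reach {v | v ≤ m ∨ m' < v} (Or.inl h1) (fun v hv => by
      by_contra hv'
      simp only [Set.mem_ofPred_eq, not_or, not_le, not_lt] at hv hv'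
      have h4 := h.middle v (by omega) (by omega)
      have h5 := h'.left v (by omega) (by omega)
      omega) (m + 1) (by omega) (by omega)
    simp only [Set.mem_ofPred_eq] at this
    omega
  exact ⟨le_antisymm (key2 h' h) (key2 h h'), rfl⟩

/-- Take c to be the largest child of a and D the set of its descendants. Non-crossing makes D an
interval that ends at b. -/
theorem IsCode.exists_split {a b : ℤ} {x : Code} (hx : IsCode a b a x) (hab : a < b) :
    ∃ m c, Split a b m c x := by
  classical
  have hne : ((Finset.Ioc a b).filter fun v => x.1 v = a).Nonempty := by
    by_contra hne
    rw [Finset.not_nonempty_iff_eq_empty, Finset.filter_eq_empty_iff] at hne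
    have := hx.reach {a} rfl (fun v hv => by
      by_contra hva
      rw [Set.mem_singleton_iff] at hv hva
      have hv1 : a ≤ v ∧ v ≤ b := by
        by_contra hcon
        have := hx.fix v (by omega)
        omega
      exact hne (x := v) (Finset.mem_Ioc.2 (by omega)) hv) b hab.le le_rfl
    rw [Set.mem_singleton_iff] at this
    omega
  obtain ⟨c, hcm, hmax⟩ := Finset.exists_max_image _ id hne
  simp only [Finset.mem_filter, Finset.mem_Ioc, id_eq] at hcm hmax
  obtain ⟨⟨hac, hcb⟩, hpc⟩ := hcm
  set D : Set ℤ := {v | ∃ k : ℕ, x.1^[k] v = c} with hD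
  have hcD : c ∈ D := ⟨0, rfl⟩
  have hD1 : ∀ v, x.1 v ∈ D → v ∈ D := fun v ⟨k, hk⟩ => ⟨k + 1, by simpa using hk⟩
  have hD2 : ∀ v, v ∈ D → v ≠ c → x.1 v ∈ D := by
    rintro v ⟨k, hk⟩ hv
    cases k with
    | zero => exact absurd hk hv
    | succ k => exact ⟨k, by simpa using hk⟩
  have haD : a ∉ D := by
    rintro ⟨k, hk⟩
    rw [Function.iterate_fixed hx.root] at hk
    omega
  have hDab : ∀ v ∈ D, a < v ∧ v ≤ b := by
    intro v hv
    by_contra hcon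
    obtain ⟨k, hk⟩ := hv
    rw [Function.iterate_fixed] at hk
    · omega
    · rcases eq_or_ne v a with rfl | hva
      · exact hx.root
      · exact hx.fix v (by omega)
  have hright : ∀ v, c ≤ v → v ≤ b → v ∈ D := by
    intro v hcv hvb
    -- A vertex beyond c and outside D cannot have a parent before c: the parent a contradicts the
    -- choice of c, and any other gives an edge crossing ac. So such vertices would never reach the
    -- root.
    have := hx.reach {v | v < c ∨ v ∈ D ∨ b < v} (Or.inl hac) (fun w hw => by
      simp only [Set.mem_ofPred_eq] at hw ⊢
      by_contra hcon
      simp only [not_or, not_lt] at hcon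
      obtain ⟨h1, h2, h3⟩ := hcon
      have h4 := hx.maps w (by omega) h3
      rcases hw with hw | hw | hw
      · have hwc : w ≠ c := fun h => h2 (h ▸ hcD)
        rcases eq_or_ne (x.1 w) a with h5 | h5
        · have := hmax w ⟨by omega, h5⟩
          omega
        · exact hx.cross a (x.1 w) c w (by omega) hw (by omega) (Or.inr hpc) (Or.inr rfl)
      · exact h2 (hD1 w hw)
      · omega) v (by omega) hvb
    rcases this with h | h | h
    · omega
    · exact h
    · omega
  have hconv : ∀ s y, s ∈ D → s < y → y < c → y ∈ D := by
    intro s y hs hsy hyc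
    by_contra hy
    -- The path from s to c stays in D, so it avoids y and must jump over it along some edge from q
    -- to its parent.
    obtain ⟨q, hqD, hqy, hyq⟩ : ∃ q ∈ D, q < y ∧ y < x.1 q := by
      by_contra hcon
      push Not at hcon
      obtain ⟨k, hk⟩ := hs
      have : ∀ j : ℕ, j ≤ k → x.1^[j] s < y := by
        intro j
        induction j with
        | zero => intro _; exact hsy
        | succ j ih =>
          intro hj
          have h1 := ih (by omega)
          have h2 : x.1^[j] s ∈ D := ⟨k - j, by
            rw [← Function.iterate_add_apply, Nat.sub_add_cancel (by omega), hk]⟩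
          have h3 := hcon _ h2 h1
          have h4 : x.1 (x.1^[j] s) ≠ y := fun h => hy (h ▸ hD2 _ h2 (by omega))
          rw [Function.iterate_succ_apply']
          omega
      have := this k le_rfl
      omega
    have hqD' : x.1 q ∈ D := hD2 q hqD (by omega)
    have hqa := hDab q hqD
    have hqb := hDab _ hqD'
    -- The vertices under this edge that are not in D are trapped: they cannot cross the edge, nor
    -- have a parent in D.
    have := hx.reach {v | v < q ∨ x.1 q < v ∨ v ∈ D} (Or.inl hqa.1) (fun w hw => by
      simp only [Set.mem_ofPred_eq] at hw ⊢
      by_contra hcon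
      simp only [not_or, not_lt] at hcon
      obtain ⟨h1, h2, h3⟩ := hcon
      have h4 : w ≠ q := fun h => h3 (h ▸ hqD)
      have h5 : w ≠ x.1 q := fun h => h3 (h ▸ hqD')
      rcases hw with hw | hw | hw
      · exact hx.cross (x.1 w) q w (x.1 q) hw (by omega) (by omega) (Or.inr rfl) (Or.inl rfl)
      · exact hx.cross q w (x.1 q) (x.1 w) (by omega) (by omega) hw (Or.inl rfl) (Or.inl rfl)
      · exact h3 (hD1 w hw)) y (by omega) (by omega)
    rcases this with h | h | h
    · omega
    · omega
    · exact hy h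
  have hneD : ((Finset.Icc a b).filter fun v => v ∈ D).Nonempty :=
    ⟨c, by simp only [Finset.mem_filter, Finset.mem_Icc]; exact ⟨⟨by omega, by omega⟩, hcD⟩⟩
  obtain ⟨m, hmm, hmin⟩ := Finset.exists_min_image _ id hneD
  simp only [Finset.mem_filter, Finset.mem_Icc, id_eq] at hmm hmin
  have ham := hDab m hmm.2
  have hmc := hmin c ⟨by omega, hcD⟩
  have hmem : ∀ v, m ≤ v → v ≤ b → v ∈ D := by
    intro v h1 h2
    rcases lt_or_ge v c with h | h
    · rcases eq_or_ne v m with rfl | hv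
      · exact hmm.2
      · exact hconv m v hmm.2 (by omega) h
    · exact hright v h h2
  have hge : ∀ v ∈ D, m ≤ v := fun v hv => hmin v ⟨by have := hDab v hv; omega, hv⟩
  -- Here `m` is the least descendant of c, so the first part ends at `m - 1`.
  refine ⟨m - 1, c, by omega, by omega, hcb, hpc, ?_, ?_, ?_⟩
  · intro v h1 h2
    by_contra hcon
    have h3 := hx.maps v h1 (by omega)
    have := hge v (hD1 v (hmem _ (by omega) h3.2))
    omega
  · intro v h1 h2
    have h3 : x.1 v ∈ D := hD2 v (hmem v (by omega) (by omega)) (by omega)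
    have h4 := hge _ h3
    refine ⟨by omega, ?_⟩
    by_contra hcon
    exact hx.cross a v c (x.1 v) (by omega) h2 (by omega) (Or.inr hpc) (Or.inl rfl)
  · intro v h1 h2
    have h3 : x.1 v ∈ D := hD2 v (hmem v (by omega) h2) (by omega)
    have h4 := hDab _ h3
    by_contra hcon
    exact hx.cross a (x.1 v) c v (by omega) (by omega) h1 (Or.inr hpc) (Or.inr rfl)

/-- As r is outside (lo, hi], every path to r leaves this set, and by `hmap` it can do so only at
lo. A gap covered by an edge inside [lo, hi] lies inside it too. -/
theorem IsCode.resF {a b r lo hi : ℤ} {x : Code} (hx : IsCode a b r x) (hlo : a ≤ lo)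
    (hhi : hi ≤ b)
    (hmap : ∀ v, lo < v → v ≤ hi → lo ≤ x.1 v ∧ x.1 v ≤ hi) (hr : ¬ (lo < r ∧ r ≤ hi)) :
    IsCode lo hi lo (GNC.resF lo hi x) := by
  have hp : ∀ v, lo < v → v ≤ hi → (GNC.resF lo hi x).1 v = x.1 v := fun v h1 h2 => if_pos ⟨h1, h2⟩
  have hn : ∀ v, ¬ (lo < v ∧ v ≤ hi) → (GNC.resF lo hi x).1 v = v := fun v h => if_neg h
  have hE : ∀ s u, s ≠ u → (GNC.resF lo hi x).1 s = u → x.1 s = u := by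
    intro s u hsu h
    by_cases hs : lo < s ∧ s ≤ hi
    · rwa [hp s hs.1 hs.2] at h
    · rw [hn s hs] at h; exact absurd h hsu
  refine ⟨fun v hv => hn v (by omega), hn lo (by omega), ?_, ?_, ?_, fun g hg => hg.2, ?_, ?_⟩
  · intro v h1 h2
    by_cases hv : lo < v
    · rw [hp v hv h2]; exact hmap v hv h2
    · rw [hn v (by omega)]; exact ⟨h1, h2⟩
  · intro S hS hcl v h1 h2
    have := hx.reach {v | v ∈ S ∨ ¬ (lo < v ∧ v ≤ hi)} (Or.inr hr) (fun w hw => by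
      by_cases hw1 : lo < w ∧ w ≤ hi
      · left
        apply hcl
        rw [hp w hw1.1 hw1.2]
        have h3 := hmap w hw1.1 hw1.2
        rcases hw with hw | hw
        · exact hw
        · have : x.1 w = lo := by omega
          rwa [this]
      · exact Or.inr hw1) v (by omega) (by omega)
    rcases this with h | h
    · exact h
    · have : v = lo := by omega
      rwa [this]
  · intro s t u v h1 h2 h3 h4 h5
    exact hx.cross s t u v h1 h2 h3
      (h4.imp (hE _ _ (by omega)) (hE _ _ (by omega))) (h5.imp (hE _ _ (by omega)) (hE _ _ (by omega)))
  · intro v hv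
    by_cases hv1 : lo < v ∧ v ≤ hi
    · rw [hp v hv1.1 hv1.2] at hv ⊢
      obtain ⟨g, hg, h1, h2⟩ := hx.up v hv
      have := hmap v hv1.1 hv1.2
      exact ⟨g, ⟨hg, by omega, by omega⟩, h1, h2⟩
    · rw [hn v hv1] at hv; omega
  · intro v hv
    by_cases hv1 : lo < v ∧ v ≤ hi
    · rw [hp v hv1.1 hv1.2] at hv ⊢
      obtain ⟨g, hg, h1, h2⟩ := hx.down v hv
      have := hmap v hv1.1 hv1.2
      exact ⟨g, ⟨hg, by omega, by omega⟩, h1, h2⟩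
    · rw [hn v hv1] at hv; omega

theorem IsCode.resL {a b r lo hi : ℤ} {x : Code} (hx : IsCode a b r x) (hlo : a ≤ lo)
    (hhi : hi ≤ b)
    (hmap : ∀ v, lo ≤ v → v < hi → lo ≤ x.1 v ∧ x.1 v ≤ hi) (hr : ¬ (lo ≤ r ∧ r < hi)) :
    IsCode lo hi hi (GNC.resL lo hi x) := by
  have hp : ∀ v, lo ≤ v → v < hi → (GNC.resL lo hi x).1 v = x.1 v := fun v h1 h2 => if_pos ⟨h1, h2⟩
  have hn : ∀ v, ¬ (lo ≤ v ∧ v < hi) → (GNC.resL lo hi x).1 v = v := fun v h => if_neg h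
  have hE : ∀ s u, s ≠ u → (GNC.resL lo hi x).1 s = u → x.1 s = u := by
    intro s u hsu h
    by_cases hs : lo ≤ s ∧ s < hi
    · rwa [hp s hs.1 hs.2] at h
    · rw [hn s hs] at h; exact absurd h hsu
  refine ⟨fun v hv => hn v (by omega), hn hi (by omega), ?_, ?_, ?_, fun g hg => hg.2, ?_, ?_⟩
  · intro v h1 h2
    by_cases hv : v < hi
    · rw [hp v h1 hv]; exact hmap v h1 hv
    · rw [hn v (by omega)]; exact ⟨h1, h2⟩
  · intro S hS hcl v h1 h2
    have := hx.reach {v | v ∈ S ∨ ¬ (lo ≤ v ∧ v < hi)} (Or.inr hr) (fun w hw => by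
      by_cases hw1 : lo ≤ w ∧ w < hi
      · left
        apply hcl
        rw [hp w hw1.1 hw1.2]
        have h3 := hmap w hw1.1 hw1.2
        rcases hw with hw | hw
        · exact hw
        · have : x.1 w = hi := by omega
          rwa [this]
      · exact Or.inr hw1) v (by omega) (by omega)
    rcases this with h | h
    · exact h
    · have : v = hi := by omega
      rwa [this]
  · intro s t u v h1 h2 h3 h4 h5
    exact hx.cross s t u v h1 h2 h3
      (h4.imp (hE _ _ (by omega)) (hE _ _ (by omega))) (h5.imp (hE _ _ (by omega)) (hE _ _ (by omega)))
  · intro v hv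
    by_cases hv1 : lo ≤ v ∧ v < hi
    · rw [hp v hv1.1 hv1.2] at hv ⊢
      obtain ⟨g, hg, h1, h2⟩ := hx.up v hv
      have := hmap v hv1.1 hv1.2
      exact ⟨g, ⟨hg, by omega, by omega⟩, h1, h2⟩
    · rw [hn v hv1] at hv; omega
  · intro v hv
    by_cases hv1 : lo ≤ v ∧ v < hi
    · rw [hp v hv1.1 hv1.2] at hv ⊢
      obtain ⟨g, hg, h1, h2⟩ := hx.down v hv
      have := hmap v hv1.1 hv1.2
      exact ⟨g, ⟨hg, by omega, by omega⟩, h1, h2⟩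
    · rw [hn v hv1] at hv; omega

/-! ### Gluing three codes -/

section Glue

variable {a b m c : ℤ} {x y z : Code} {e : Prop}

theorem glue_of_le {v : ℤ} (h : v ≤ m) : (glue a m c x y z e).1 v = x.1 v := if_pos h

theorem glue_of_lt {v : ℤ} (h : m < v) (h' : v < c) : (glue a m c x y z e).1 v = y.1 v := by
  simp only [glue, if_neg (not_le.2 h), if_pos h']

theorem glue_self (h : m < c) : (glue a m c x y z e).1 c = a := by
  simp only [glue, if_neg (not_le.2 h), lt_irrefl, if_false, if_true]

theorem glue_of_gt {v : ℤ} (h : m < c) (h' : c < v) : (glue a m c x y z e).1 v = z.1 v := by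
  simp only [glue, if_neg (not_le.2 (h.trans h')), if_neg (not_lt.2 h'.le), if_neg h'.ne']

theorem split_glue (hx : IsCode a m a x) (hy : IsCode (m + 1) c c y) (hz : IsCode c b c z)
    (h1 : a ≤ m) (h2 : m < c) (h3 : c ≤ b) : Split a b m c (glue a m c x y z e) where
  le_m := h1
  m_lt := h2
  le_b := h3
  parent := glue_self h2
  left v h h' := by rw [glue_of_le h']; exact (hx.maps v h h').2
  middle v h h' := by
    rw [glue_of_lt h h']
    have := hy.maps v (by omega) h'.le
    omega
  right v h h' := by rw [glue_of_gt h2 h]; exact (hz.maps v h.le h').1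

/-- The only new edge is ac. It covers the gap m and all gaps of x and y; a nontrivial part has an
edge and hence a gap, so `he` is needed only when both parts are single vertices. -/
theorem isCode_glue (hx : IsCode a m a x) (hy : IsCode (m + 1) c c y) (hz : IsCode c b c z)
    (h1 : a ≤ m) (h2 : m < c) (h3 : c ≤ b) (he : m = a → c = m + 1 → e) :
    IsCode a b a (glue a m c x y z e) := by
  set w := glue a m c x y z e with hw
  have hcases : ∀ v, (v ≤ m ∧ w.1 v = x.1 v) ∨ (m < v ∧ v < c ∧ w.1 v = y.1 v) ∨
      (v = c ∧ w.1 v = a) ∨ (c < v ∧ w.1 v = z.1 v) := by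
    intro v
    rcases le_or_gt v m with h | h
    · exact Or.inl ⟨h, glue_of_le h⟩
    · rcases lt_trichotomy v c with h' | rfl | h'
      · exact Or.inr (Or.inl ⟨h, h', glue_of_lt h h'⟩)
      · exact Or.inr (Or.inr (Or.inl ⟨rfl, glue_self h2⟩))
      · exact Or.inr (Or.inr (Or.inr ⟨h', glue_of_gt h2 h'⟩))
  have hfix : ∀ v, v < a ∨ b < v → w.1 v = v := by
    intro v hv
    rcases hcases v with ⟨h, h'⟩ | ⟨h, h', h''⟩ | ⟨h, h'⟩ | ⟨h, h'⟩
    · rw [h', hx.fix v (by omega)]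
    · omega
    · omega
    · rw [h', hz.fix v (by omega)]
  have hedge : ∀ s u, s < u → (w.1 s = u ∨ w.1 u = s) →
      (a ≤ s ∧ u ≤ m ∧ (x.1 s = u ∨ x.1 u = s)) ∨ (m < s ∧ u ≤ c ∧ (y.1 s = u ∨ y.1 u = s)) ∨
      (c ≤ s ∧ u ≤ b ∧ (z.1 s = u ∨ z.1 u = s)) ∨ (s = a ∧ u = c) := by
    have key : ∀ v u, v ≠ u → w.1 v = u →
      (a ≤ v ∧ v ≤ m ∧ a ≤ u ∧ u ≤ m ∧ x.1 v = u) ∨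
      (m < v ∧ v ≤ c ∧ m < u ∧ u ≤ c ∧ y.1 v = u) ∨
      (c ≤ v ∧ v ≤ b ∧ c ≤ u ∧ u ≤ b ∧ z.1 v = u) ∨ (v = c ∧ u = a) := by
      intro v u hne hv
      have hv1 : a ≤ v ∧ v ≤ b := by
        by_contra hcon
        have := hfix v (by omega)
        omega
      rcases hcases v with ⟨h, h'⟩ | ⟨h, h', h''⟩ | ⟨h, h'⟩ | ⟨h, h'⟩
      · have := hx.maps v hv1.1 h
        left; omega
      · have := hy.maps v (by omega) h'.le
        right; left; omega
      · right; right; right; omega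
      · have := hz.maps v h.le hv1.2
        right; right; left; omega
    rintro s u hsu (h | h)
    · rcases key s u (by omega) h with h | h | h | h
      · exact Or.inl ⟨h.1, h.2.2.2.1, Or.inl h.2.2.2.2⟩
      · exact Or.inr (Or.inl ⟨h.1, h.2.2.2.1, Or.inl h.2.2.2.2⟩)
      · exact Or.inr (Or.inr (Or.inl ⟨h.1, h.2.2.2.1, Or.inl h.2.2.2.2⟩))
      · omega
    · rcases key u s (by omega) h with h | h | h | h
      · exact Or.inl ⟨h.2.2.1, h.2.1, Or.inr h.2.2.2.2⟩
      · exact Or.inr (Or.inl ⟨h.2.2.1, h.2.1, Or.inr h.2.2.2.2⟩)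
      · exact Or.inr (Or.inr (Or.inl ⟨h.2.2.1, h.2.1, Or.inr h.2.2.2.2⟩))
      · exact Or.inr (Or.inr (Or.inr ⟨h.2, h.1⟩))
  refine ⟨hfix, ?_, ?_, ?_, ?_, ?_, ?_, ?_⟩
  · rw [hw, glue_of_le h1, hx.root]
  · intro v hv1 hv2
    rcases hcases v with ⟨h, h'⟩ | ⟨h, h', h''⟩ | ⟨h, h'⟩ | ⟨h, h'⟩
    · have := hx.maps v hv1 h
      omega
    · have := hy.maps v (by omega) h'.le
      omega
    · omega
    · have := hz.maps v h.le hv2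
      omega
  · intro S hS hcl
    have hxS : ∀ v, a ≤ v → v ≤ m → v ∈ S := by
      intro v hv1 hv2
      have := hx.reach {v | v ∈ S ∨ m < v} (Or.inl hS) (fun u hu => by
        by_cases hum : u ≤ m
        · left
          apply hcl
          rw [hw, glue_of_le hum]
          rcases hu with hu | hu
          · exact hu
          · rcases lt_or_ge u a with h | h
            · have := hx.fix u (by omega)
              have hu' : m < x.1 u := hu
              omega
            · have := hx.maps u h hum
              have hu' : m < x.1 u := hu
              omega
        · exact Or.inr (not_le.1 hum)) v hv1 hv2
      rcases this with h | h
      · exact h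
      · exact absurd hv2 (not_le.2 h)
    have hcS : c ∈ S := hcl c (by rw [hw, glue_self h2]; exact hS)
    have hyS : ∀ v, m < v → v ≤ c → v ∈ S := by
      intro v hv1 hv2
      have := hy.reach {v | v ∈ S ∨ ¬ (m < v ∧ v < c)} (Or.inl hcS) (fun u hu => by
        by_cases hum : m < u ∧ u < c
        · left
          apply hcl
          rw [hw, glue_of_lt hum.1 hum.2]
          rcases hu with hu | hu
          · exact hu
          · have := hy.maps u (by omega) hum.2.le
            have : y.1 u = c := by omega
            rwa [this]
        · exact Or.inr hum) v (by omega) hv2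
      rcases this with h | h
      · exact h
      · have : v = c := by omega
        rwa [this]
    have hzS : ∀ v, c ≤ v → v ≤ b → v ∈ S := by
      intro v hv1 hv2
      have := hz.reach {v | v ∈ S ∨ ¬ (c < v ∧ v ≤ b)} (Or.inl hcS) (fun u hu => by
        by_cases hum : c < u ∧ u ≤ b
        · left
          apply hcl
          rw [hw, glue_of_gt h2 hum.1]
          rcases hu with hu | hu
          · exact hu
          · have := hz.maps u hum.1.le hum.2
            have : z.1 u = c := by omega
            rwa [this]
        · exact Or.inr hum) v hv1 hv2
      rcases this with h | h
      · exact h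
      · have : v = c := by omega
        rwa [this]
    intro v hv1 hv2
    rcases le_or_gt v m with h | h
    · exact hxS v hv1 h
    · rcases le_or_gt v c with h' | h'
      · exact hyS v h h'
      · exact hzS v h'.le hv2
  · intro s t u v hst htu huv hsu htv
    -- Edges from different parts lie in intervals with at most an endpoint in common, and each part
    -- lies on one side of ac; only two edges of the same part need an argument.
    rcases hedge s u (by omega) hsu with h | h | h | h <;>
      rcases hedge t v (by omega) htv with h' | h' | h' | h' <;>
      first
      | omega
      | exact hx.cross s t u v hst htu huv h.2.2 h'.2.2
      | exact hy.cross s t u v hst htu huv h.2.2 h'.2.2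
      | exact hz.cross s t u v hst htu huv h.2.2 h'.2.2
  · rintro g (hg | hg | hg | ⟨hg, -⟩)
    · have := hx.gaps g hg; omega
    · have := hy.gaps g hg; omega
    · have := hz.gaps g hg; omega
    · omega
  · intro v hv
    rcases hcases v with ⟨h, h'⟩ | ⟨h, h', h''⟩ | ⟨h, h'⟩ | ⟨h, h'⟩
    · rw [h'] at hv ⊢
      obtain ⟨g, hg, h4⟩ := hx.up v hv
      exact ⟨g, Or.inl hg, h4⟩
    · rw [h''] at hv ⊢
      obtain ⟨g, hg, h4⟩ := hy.up v hv
      exact ⟨g, Or.inr (Or.inl hg), h4⟩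
    · omega
    · rw [h'] at hv ⊢
      obtain ⟨g, hg, h4⟩ := hz.up v hv
      exact ⟨g, Or.inr (Or.inr (Or.inl hg)), h4⟩
  · intro v hv
    rcases hcases v with ⟨h, h'⟩ | ⟨h, h', h''⟩ | ⟨rfl, h'⟩ | ⟨h, h'⟩
    · rw [h'] at hv ⊢
      obtain ⟨g, hg, h4⟩ := hx.down v hv
      exact ⟨g, Or.inl hg, h4⟩
    · rw [h''] at hv ⊢
      obtain ⟨g, hg, h4⟩ := hy.down v hv
      exact ⟨g, Or.inr (Or.inl hg), h4⟩
    · rw [h']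
      rcases eq_or_ne m a with hma | hma
      · rcases eq_or_ne v (m + 1) with hv1 | hv1
        · exact ⟨m, Or.inr (Or.inr (Or.inr ⟨rfl, he hma hv1⟩)), h1, h2⟩
        · obtain ⟨g, hg⟩ : ∃ g, g ∈ y.2 := by
            have hne : y.1 (m + 1) ≠ m + 1 := by
              intro h
              have := hy.reach {u | u ≠ m + 1} hv1 (fun u hu hcon => hu (by rw [hcon, h]))
                (m + 1) le_rfl (by omega)
              exact this rfl
            rcases lt_or_gt_of_ne hne with h | h
            · obtain ⟨g, hg, -⟩ := hy.down _ h
              exact ⟨g, hg⟩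
            · obtain ⟨g, hg, -⟩ := hy.up _ h
              exact ⟨g, hg⟩
          have := hy.gaps g hg
          exact ⟨g, Or.inr (Or.inl hg), by omega, by omega⟩
      · obtain ⟨g, hg⟩ : ∃ g, g ∈ x.2 := by
          have hne : x.1 m ≠ m := by
            intro h
            have := hx.reach {u | u ≠ m} (Ne.symm hma) (fun u hu hcon => hu (by rw [hcon, h]))
              m h1 le_rfl
            exact this rfl
          rcases lt_or_gt_of_ne hne with h | h
          · obtain ⟨g, hg, -⟩ := hx.down _ h
            exact ⟨g, hg⟩
          · obtain ⟨g, hg, -⟩ := hx.up _ h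
            exact ⟨g, hg⟩
        have := hx.gaps g hg
        exact ⟨g, Or.inl hg, by omega, by omega⟩
    · rw [h'] at hv ⊢
      obtain ⟨g, hg, h4⟩ := hz.down v hv
      exact ⟨g, Or.inr (Or.inr (Or.inl hg)), h4⟩

end Glue

end GNC

/-! ### Counting codes by their parts -/

namespace GNC

/-- The three parts of a split code, and whether the gap between the first two belongs to it. -/
noncomputable def parts (a b m c : ℤ) (x : Code) : Code × Code × Code × Prop :=
  (resF a m x, resL (m + 1) c x, resF c b x, m ∈ x.2)

theorem resF_fst_of_mem {lo hi v : ℤ} {x : Code} (h : lo < v) (h' : v ≤ hi) :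
    (resF lo hi x).1 v = x.1 v := if_pos ⟨h, h'⟩

theorem resF_fst_of_not_mem {lo hi v : ℤ} {x : Code} (h : ¬ (lo < v ∧ v ≤ hi)) :
    (resF lo hi x).1 v = v := if_neg h

theorem resL_fst_of_mem {lo hi v : ℤ} {x : Code} (h : lo ≤ v) (h' : v < hi) :
    (resL lo hi x).1 v = x.1 v := if_pos ⟨h, h'⟩

theorem resL_fst_of_not_mem {lo hi v : ℤ} {x : Code} (h : ¬ (lo ≤ v ∧ v < hi)) :
    (resL lo hi x).1 v = v := if_neg h

/-- The parts record the gaps in [a, m), [m + 1, c) and [c, b), which are all but m; this is why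
`parts` has a fourth component. -/
theorem parts_injOn (a b m c : ℤ) :
    Set.InjOn (parts a b m c) {x | IsCode a b a x ∧ Split a b m c x} := by
  rintro x ⟨hx, sx⟩ y ⟨hy, sy⟩ h
  simp only [parts, Prod.mk.injEq] at h
  obtain ⟨h1, h2, h3, h4⟩ := h
  have l1 := sx.le_m
  have l2 := sx.m_lt
  have l3 := sx.le_b
  refine Prod.ext (funext fun v => ?_) (Set.ext fun g => ?_)
  · by_cases hab : v < a ∨ b < v
    · rw [hx.fix v hab, hy.fix v hab]
    · rcases eq_or_ne v a with rfl | hva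
      · rw [hx.root, hy.root]
      · rcases le_or_gt v m with hvm | hvm
        · have := congrFun (congrArg Prod.fst h1) v
          rwa [resF_fst_of_mem (by omega) hvm, resF_fst_of_mem (by omega) hvm] at this
        · rcases lt_trichotomy v c with hvc | rfl | hvc
          · have := congrFun (congrArg Prod.fst h2) v
            rwa [resL_fst_of_mem (by omega) hvc, resL_fst_of_mem (by omega) hvc] at this
          · rw [sx.parent, sy.parent]
          · have := congrFun (congrArg Prod.fst h3) v
            rwa [resF_fst_of_mem hvc (by omega), resF_fst_of_mem hvc (by omega)] at this
  · by_cases hg : a ≤ g ∧ g < b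
    · rcases lt_trichotomy g m with hgm | rfl | hgm
      · have := Set.ext_iff.1 (congrArg Prod.snd h1) g
        simp only [resF, Set.mem_ofPred_eq] at this
        exact ⟨fun h => (this.1 ⟨h, hg.1, hgm⟩).1, fun h => (this.2 ⟨h, hg.1, hgm⟩).1⟩
      · exact iff_of_eq h4
      · rcases lt_or_ge g c with hgc | hgc
        · have := Set.ext_iff.1 (congrArg Prod.snd h2) g
          simp only [resL, Set.mem_ofPred_eq] at this
          exact ⟨fun h => (this.1 ⟨h, hgm, hgc⟩).1, fun h => (this.2 ⟨h, hgm, hgc⟩).1⟩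
        · have := Set.ext_iff.1 (congrArg Prod.snd h3) g
          simp only [resF, Set.mem_ofPred_eq] at this
          exact ⟨fun h => (this.1 ⟨h, hgc, hg.2⟩).1, fun h => (this.2 ⟨h, hgc, hg.2⟩).1⟩
    · exact ⟨fun h => absurd (hx.gaps g h) hg, fun h => absurd (hy.gaps g h) hg⟩

theorem parts_glue {a b m c : ℤ} {x y z : Code} {e : Prop} (hx : IsCode a m a x)
    (hy : IsCode (m + 1) c c y) (hz : IsCode c b c z) (h1 : a ≤ m) (h2 : m < c) (h3 : c ≤ b) :
    parts a b m c (glue a m c x y z e) = (x, y, z, e) := by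
  simp only [parts, Prod.mk.injEq]
  refine ⟨Prod.ext (funext fun v => ?_) (Set.ext fun g => ?_),
    Prod.ext (funext fun v => ?_) (Set.ext fun g => ?_),
    Prod.ext (funext fun v => ?_) (Set.ext fun g => ?_), propext ?_⟩
  · by_cases h : a < v ∧ v ≤ m
    · rw [resF_fst_of_mem h.1 h.2, glue_of_le h.2]
    · rw [resF_fst_of_not_mem h]
      rcases eq_or_ne v a with rfl | hv
      · exact hx.root.symm
      · exact (hx.fix v (by omega)).symm
  · have i1 := hx.gaps g
    have i2 := hy.gaps g
    have i3 := hz.gaps g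
    simp only [resF, glue, Set.mem_ofPred_eq]
    constructor
    · rintro ⟨h | h | h | h, h', h''⟩
      · exact h
      · have := i2 h; omega
      · have := i3 h; omega
      · omega
    · exact fun h => ⟨Or.inl h, i1 h⟩
  · by_cases h : m + 1 ≤ v ∧ v < c
    · rw [resL_fst_of_mem h.1 h.2, glue_of_lt (by omega) h.2]
    · rw [resL_fst_of_not_mem h]
      rcases eq_or_ne v c with rfl | hv
      · exact hy.root.symm
      · exact (hy.fix v (by omega)).symm
  · have i1 := hx.gaps g
    have i2 := hy.gaps g
    have i3 := hz.gaps g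
    simp only [resL, glue, Set.mem_ofPred_eq]
    constructor
    · rintro ⟨h | h | h | h, h', h''⟩
      · have := i1 h; omega
      · exact h
      · have := i3 h; omega
      · omega
    · exact fun h => ⟨Or.inr (Or.inl h), i2 h⟩
  · by_cases h : c < v ∧ v ≤ b
    · rw [resF_fst_of_mem h.1 h.2, glue_of_gt h2 h.1]
    · rw [resF_fst_of_not_mem h]
      rcases eq_or_ne v c with rfl | hv
      · exact hz.root.symm
      · exact (hz.fix v (by omega)).symm
  · have i1 := hx.gaps g
    have i2 := hy.gaps g
    have i3 := hz.gaps g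
    simp only [resF, glue, Set.mem_ofPred_eq]
    constructor
    · rintro ⟨h | h | h | h, h', h''⟩
      · have := i1 h; omega
      · have := i2 h; omega
      · exact h
      · omega
    · exact fun h => ⟨Or.inr (Or.inr (Or.inl h)), i3 h⟩
  · have i1 := hx.gaps m
    have i2 := hy.gaps m
    have i3 := hz.gaps m
    simp only [glue, Set.mem_ofPred_eq, true_and]
    constructor
    · rintro (h | h | h | h)
      · have := i1 h; omega
      · have := i2 h; omega
      · have := i3 h; omega
      · exact h
    · exact fun h => Or.inr (Or.inr (Or.inr h))

/-- The codes on the interval from `a` to `b` with root `r` that satisfy `Q`. -/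
def codes (Q : Code → Prop) (a b r : ℤ) : Set Code := {x | IsCode a b r x ∧ Q x}

theorem parts_mem {a b m c : ℤ} {x : Code} (hx : IsCode a b a x) (s : Split a b m c x) :
    IsCode a m a (resF a m x) ∧ IsCode (m + 1) c c (resL (m + 1) c x) ∧
      IsCode c b c (resF c b x) ∧ (m = a → c = m + 1 → m ∈ x.2) := by
  have l1 := s.le_m
  have l2 := s.m_lt
  have l3 := s.le_b
  refine ⟨hx.resF le_rfl (by omega) ?_ (by omega), hx.resL (by omega) l3 ?_ (by omega),
    hx.resF (by omega) le_rfl ?_ (by omega), ?_⟩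
  · intro v h h'
    exact ⟨(hx.maps v h.le (by omega)).1, s.left v h.le h'⟩
  · intro v h h'
    have := s.middle v (by omega) h'
    omega
  · intro v h h'
    exact ⟨s.right v h h', (hx.maps v (by omega) h').2⟩
  · intro h h'
    obtain ⟨g, hg, h4, h5⟩ := hx.down c (by rw [s.parent]; omega)
    rw [s.parent] at h4
    have : g = m := by omega
    rwa [← this]

/-- `parts` is a bijection onto a product whose last factor is the choice whether the gap m is
taken: forced when ac covers no other gap, free otherwise. -/
theorem ncard_split {Q Q₁ Q₂ Q₃ : Code → Prop} {a b m c : ℤ} (h1 : a ≤ m) (h2 : m < c) (h3 : c ≤ b)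
    (hQ : ∀ x, IsCode a b a x → Split a b m c x →
      (Q x ↔ Q₁ (resF a m x) ∧ Q₂ (resL (m + 1) c x) ∧ Q₃ (resF c b x))) :
    {x ∈ codes Q a b a | Split a b m c x}.ncard =
      (if m = a ∧ c = m + 1 then 1 else 2) * ((codes Q₁ a m a).ncard *
        (codes Q₂ (m + 1) c c).ncard) * (codes Q₃ c b c).ncard := by
  have hinj : Set.InjOn (parts a b m c) {x ∈ codes Q a b a | Split a b m c x} :=
    (parts_injOn a b m c).mono (by rintro x ⟨hx, s⟩; exact ⟨hx.1, s⟩)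
  have himg : parts a b m c '' {x ∈ codes Q a b a | Split a b m c x} =
      codes Q₁ a m a ×ˢ codes Q₂ (m + 1) c c ×ˢ codes Q₃ c b c ×ˢ
        {e : Prop | m = a → c = m + 1 → e} := by
    ext ⟨x, y, z, e⟩
    simp only [Set.mem_image, Set.mem_prod]
    constructor
    · rintro ⟨w, ⟨⟨hw, qw⟩, sw⟩, h⟩
      simp only [parts, Prod.mk.injEq] at h
      obtain ⟨rfl, rfl, rfl, rfl⟩ := h
      have hp := parts_mem hw sw
      have hq := (hQ w hw sw).1 qw
      exact ⟨⟨hp.1, hq.1⟩, ⟨hp.2.1, hq.2.1⟩, ⟨hp.2.2.1, hq.2.2⟩, hp.2.2.2⟩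
    · rintro ⟨⟨hx, qx⟩, ⟨hy, qy⟩, ⟨hz, qz⟩, he⟩
      have hp := parts_glue (e := e) hx hy hz h1 h2 h3
      have hc := isCode_glue hx hy hz h1 h2 h3 he
      have hs := split_glue (e := e) hx hy hz h1 h2 h3
      refine ⟨glue a m c x y z e, ⟨⟨hc, (hQ _ hc hs).2 ?_⟩, hs⟩, hp⟩
      simp only [parts, Prod.mk.injEq] at hp
      rw [hp.1, hp.2.1, hp.2.2.1]
      exact ⟨qx, qy, qz⟩
  have hbit : {e : Prop | m = a → c = m + 1 → e}.ncard = if m = a ∧ c = m + 1 then 1 else 2 := by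
    split_ifs with h
    · have : {e : Prop | m = a → c = m + 1 → e} = {True} := by
        ext e
        rw [Set.mem_singleton_iff]
        exact ⟨fun h4 => eq_true (h4 h.1 h.2), fun h4 _ _ => of_eq_true h4⟩
      rw [this, Set.ncard_singleton]
    · have : {e : Prop | m = a → c = m + 1 → e} = Set.univ :=
        Set.eq_univ_of_forall fun e h4 h5 => absurd ⟨h4, h5⟩ h
      rw [this, Set.ncard_univ]
      simp
  rw [← hinj.ncard_image, himg, Set.ncard_prod, Set.ncard_prod, Set.ncard_prod, hbit]
  ring

theorem codes_finite (Q : Code → Prop) (a b r : ℤ) : (codes Q a b r).Finite := by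
  have hfin : ({g : Set.Icc a b → ℤ | ∀ v, g v ∈ Set.Icc a b} ×ˢ (Set.Ico a b).powerset).Finite :=
    (Set.Finite.pi' fun _ => Set.finite_Icc a b).prod (Set.finite_Ico a b).powerset
  refine Set.Finite.of_injOn (f := fun x : Code => ((fun v : Set.Icc a b => x.1 v), x.2))
    ?_ ?_ hfin
  · rintro x ⟨hx, -⟩
    exact ⟨fun v => hx.maps v v.2.1 v.2.2, fun g hg => hx.gaps g hg⟩
  · rintro x ⟨hx, -⟩ y ⟨hy, -⟩ h
    simp only [Prod.mk.injEq] at h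
    refine Prod.ext (funext fun v => ?_) h.2
    by_cases hv : a ≤ v ∧ v ≤ b
    · exact congrFun h.1 ⟨v, hv⟩
    · rw [hx.fix v (by omega), hy.fix v (by omega)]

/-- The index records numbers of edges: `t.2` those of the left and middle parts, `t.1.2` that of
the right part, with the edge ac accounting for the + 1. -/
theorem ncard_codes_eq_sum (Q : Code → Prop) (a : ℤ) (n : ℕ) :
    (codes Q a (a + (n + 1 : ℕ)) a).ncard =
      ∑ t ∈ (Finset.HasAntidiagonal.antidiagonal n).sigma fun t => Finset.HasAntidiagonal.antidiagonal t.1,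
        {x ∈ codes Q a (a + (n + 1 : ℕ)) a |
          Split a (a + (n + 1 : ℕ)) (a + t.2.1) (a + t.2.1 + 1 + t.2.2) x}.ncard := by
  have hun : codes Q a (a + (n + 1 : ℕ)) a =
      ⋃ t ∈ (((Finset.HasAntidiagonal.antidiagonal n).sigma fun t => Finset.HasAntidiagonal.antidiagonal t.1 :
          Finset (Σ _ : ℕ × ℕ, ℕ × ℕ)) : Set (Σ _ : ℕ × ℕ, ℕ × ℕ)),
        {x ∈ codes Q a (a + (n + 1 : ℕ)) a |
          Split a (a + (n + 1 : ℕ)) (a + t.2.1) (a + t.2.1 + 1 + t.2.2) x} := by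
    ext x
    simp only [Set.mem_iUnion, exists_prop]
    constructor
    · intro hx
      obtain ⟨m, c, s⟩ := hx.1.exists_split (by omega)
      have l1 := s.le_m
      have l2 := s.m_lt
      have l3 := s.le_b
      refine ⟨⟨((c - a - 1).toNat, (a + (n + 1 : ℕ) - c).toNat),
        ((m - a).toNat, (c - m - 1).toNat)⟩, ?_, hx, ?_⟩
      · simp only [Finset.mem_coe, Finset.mem_sigma, Finset.HasAntidiagonal.mem_antidiagonal]
        omega
      · have e1 : a + ((m - a).toNat : ℤ) = m := by omega
        have e2 : m + 1 + ((c - m - 1).toNat : ℤ) = c := by omega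
        simp only [e1, e2]
        exact s
    · rintro ⟨t, -, hx, -⟩
      exact hx
  conv_lhs => rw [hun]
  rw [Set.Finite.ncard_biUnion (Finset.finite_toSet _), finsum_mem_coe_finset]
  · intro t _
    exact (codes_finite Q _ _ _).subset fun x hx => hx.1
  · rintro ⟨⟨s, k⟩, ⟨i, j⟩⟩ ht ⟨⟨s', k'⟩, ⟨i', j'⟩⟩ ht' hne
    rw [Function.onFun, Set.disjoint_left]
    rintro x ⟨hx, sx⟩ ⟨-, sx'⟩
    apply hne
    simp only [Finset.mem_coe, Finset.mem_sigma, Finset.HasAntidiagonal.mem_antidiagonal] at ht ht' sx sx'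
    have hu := sx.unique hx.1 sx'
    obtain rfl : i = i' := by omega
    obtain rfl : j = j' := by omega
    obtain rfl : s = s' := by omega
    obtain rfl : k = k' := by omega
    rfl

/-! ### The forbidden patterns and the parts -/

/-- No vertex reached by an ascent has a child reached by an ascent. -/
def UUFree (x : Code) : Prop := ∀ v, x.1 (x.1 v) < x.1 v → ¬ x.1 v < v

/-- No vertex reached by a descent has a child reached by a descent. -/
def DDFree (x : Code) : Prop := ∀ v, x.1 v < x.1 (x.1 v) → ¬ v < x.1 v

/-- No double descent involves two parts: a and c have only larger children in the first and last
parts, and c itself is reached by an ascent. A root is its own parent, so it never satisfies the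
strict inequality in the definition. -/
theorem ddFree_parts {a b m c : ℤ} {x : Code} (hx : IsCode a b a x) (s : Split a b m c x) :
    DDFree x ↔ DDFree (resF a m x) ∧ DDFree (resL (m + 1) c x) ∧ DDFree (resF c b x) := by
  have l1 := s.le_m
  have l2 := s.m_lt
  have l3 := s.le_b
  constructor
  · intro h
    refine ⟨fun v h1 h2 => ?_, fun v h1 h2 => ?_, fun v h1 h2 => ?_⟩
    · by_cases hv : a < v ∧ v ≤ m
      · rw [resF_fst_of_mem hv.1 hv.2] at h1 h2
        by_cases hv' : a < x.1 v ∧ x.1 v ≤ m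
        · rw [resF_fst_of_mem hv'.1 hv'.2] at h1
          exact h v h1 h2
        · rw [resF_fst_of_not_mem hv'] at h1; omega
      · rw [resF_fst_of_not_mem hv] at h2; omega
    · by_cases hv : m + 1 ≤ v ∧ v < c
      · rw [resL_fst_of_mem hv.1 hv.2] at h1 h2
        by_cases hv' : m + 1 ≤ x.1 v ∧ x.1 v < c
        · rw [resL_fst_of_mem hv'.1 hv'.2] at h1
          exact h v h1 h2
        · rw [resL_fst_of_not_mem hv'] at h1; omega
      · rw [resL_fst_of_not_mem hv] at h2; omega
    · by_cases hv : c < v ∧ v ≤ b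
      · rw [resF_fst_of_mem hv.1 hv.2] at h1 h2
        by_cases hv' : c < x.1 v ∧ x.1 v ≤ b
        · rw [resF_fst_of_mem hv'.1 hv'.2] at h1
          exact h v h1 h2
        · rw [resF_fst_of_not_mem hv'] at h1; omega
      · rw [resF_fst_of_not_mem hv] at h2; omega
  · rintro ⟨hF, hL, hR⟩ v h1 h2
    have hv : a ≤ v ∧ v ≤ b := by
      by_contra hcon
      have := hx.fix v (by omega)
      omega
    have hva : v ≠ a := by
      rintro rfl
      have := hx.root
      omega
    rcases le_or_gt v m with hvm | hvm
    · have h3 := hF v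
      have h4 := s.left v hv.1 hvm
      rw [resF_fst_of_mem (by omega) hvm, resF_fst_of_mem (by omega) h4] at h3
      exact h3 h1 h2
    · rcases lt_trichotomy v c with hvc | rfl | hvc
      · have h4 := s.middle v hvm hvc
        have h5 : x.1 v ≠ c := by
          intro h
          rw [h, s.parent] at h1
          omega
        have h3 := hL v
        rw [resL_fst_of_mem (by omega) hvc, resL_fst_of_mem (by omega) (by omega)] at h3
        exact h3 h1 h2
      · rw [s.parent] at h2
        omega
      · have h4 := s.right v hvc hv.2
        have h5 := hx.maps v hv.1 hv.2
        have h3 := hR v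
        rw [resF_fst_of_mem hvc hv.2, resF_fst_of_mem (by omega) h5.2] at h3
        exact h3 h1 h2

/-- Since c is reached by an ascent, it has no larger child. Vertices beyond c would then have all
their ancestors beyond c and never reach the root, so there are none. -/
theorem uuFree_parts {a b m c : ℤ} {x : Code} (hx : IsCode a b a x) (s : Split a b m c x) :
    UUFree x ↔ UUFree (resF a m x) ∧ UUFree (resL (m + 1) c x) ∧ c = b := by
  have l1 := s.le_m
  have l2 := s.m_lt
  have l3 := s.le_b
  constructor
  · intro h
    refine ⟨fun v h1 h2 => ?_, fun v h1 h2 => ?_, ?_⟩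
    · by_cases hv : a < v ∧ v ≤ m
      · rw [resF_fst_of_mem hv.1 hv.2] at h1 h2
        by_cases hv' : a < x.1 v ∧ x.1 v ≤ m
        · rw [resF_fst_of_mem hv'.1 hv'.2] at h1
          exact h v h1 h2
        · rw [resF_fst_of_not_mem hv'] at h1; omega
      · rw [resF_fst_of_not_mem hv] at h2; omega
    · by_cases hv : m + 1 ≤ v ∧ v < c
      · rw [resL_fst_of_mem hv.1 hv.2] at h1 h2
        by_cases hv' : m + 1 ≤ x.1 v ∧ x.1 v < c
        · rw [resL_fst_of_mem hv'.1 hv'.2] at h1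
          exact h v h1 h2
        · rw [resL_fst_of_not_mem hv'] at h1; omega
      · rw [resL_fst_of_not_mem hv] at h2; omega
    · by_contra hcb
      have := hx.reach {v | ¬ (c < v ∧ v ≤ b)} (by simp only [Set.mem_ofPred_eq]; omega)
        (fun v hv => by
          simp only [Set.mem_ofPred_eq] at hv ⊢
          rintro ⟨h1, h2⟩
          have h3 := s.right v h1 h2
          have h4 := hx.maps v (by omega) h2
          have h5 : x.1 v = c := by omega
          have h6 := h v
          rw [h5, s.parent] at h6
          exact h6 (by omega) h1) b (by omega) le_rfl
      simp only [Set.mem_ofPred_eq] at this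
      omega
  · rintro ⟨hF, hL, rfl⟩ v h1 h2
    have hv : a ≤ v ∧ v ≤ c := by
      by_contra hcon
      have := hx.fix v (by omega)
      omega
    have hva : v ≠ a := by
      rintro rfl
      have := hx.root
      omega
    rcases le_or_gt v m with hvm | hvm
    · have h3 := hF v
      have h4 := s.left v hv.1 hvm
      have h5 := hx.maps v hv.1 hv.2
      have h6 : x.1 v ≠ a := by
        intro h
        rw [h, hx.root] at h1
        omega
      rw [resF_fst_of_mem (by omega) hvm, resF_fst_of_mem (by omega) h4] at h3
      exact h3 h1 h2
    · rcases eq_or_lt_of_le hv.2 with rfl | hvc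
      · rw [s.parent, hx.root] at h1
        omega
      · have h4 := s.middle v hvm hvc
        have h3 := hL v
        rw [resL_fst_of_mem (by omega) hvc, resL_fst_of_mem (by omega) (by omega)] at h3
        exact h3 h1 h2

/-! ### Reflection -/

/-- The reflection of a code that sends the vertex `v` to `k - v`. -/
def mirror (k : ℤ) (x : Code) : Code := (fun v => k - x.1 (k - v), {g | k - 1 - g ∈ x.2})

theorem mirror_mirror (k : ℤ) (x : Code) : mirror k (mirror k x) = x := by
  refine Prod.ext (funext fun v => ?_) (Set.ext fun g => ?_)
  · simp [mirror]
  · simp [mirror]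

theorem IsCode.mirror {a b r : ℤ} {x : Code} (hx : IsCode a b r x) (k : ℤ) :
    IsCode (k - b) (k - a) (k - r) (GNC.mirror k x) := by
  refine ⟨fun v hv => ?_, ?_, fun v h h' => ?_, fun S hS hcl v h h' => ?_,
    fun s t u v h1 h2 h3 h4 h5 => ?_, fun g hg => ?_, fun v hv => ?_, fun v hv => ?_⟩
  · simp only [GNC.mirror]
    rw [hx.fix (k - v) (by omega)]
    omega
  · simp only [GNC.mirror, sub_sub_cancel, hx.root]
  · have := hx.maps (k - v) (by omega) (by omega)
    simp only [GNC.mirror]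
    omega
  · have := hx.reach {v | k - v ∈ S} hS (fun w hw => by
      apply hcl
      simpa [GNC.mirror] using hw) (k - v) (by omega) (by omega)
    simpa using this
  · simp only [GNC.mirror] at h4 h5
    exact hx.cross (k - v) (k - u) (k - t) (k - s) (by omega) (by omega) (by omega)
      (by omega) (by omega)
  · have := hx.gaps _ hg
    omega
  · simp only [GNC.mirror] at hv ⊢
    obtain ⟨g, hg, h1, h2⟩ := hx.down (k - v) (by omega)
    exact ⟨k - 1 - g, by simpa using hg, by omega, by omega⟩
  · simp only [GNC.mirror] at hv ⊢
    obtain ⟨g, hg, h1, h2⟩ := hx.up (k - v) (by omega)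
    exact ⟨k - 1 - g, by simpa using hg, by omega, by omega⟩

theorem UUFree.mirror {x : Code} (h : UUFree x) (k : ℤ) : DDFree (GNC.mirror k x) := by
  intro v h1 h2
  simp only [GNC.mirror, sub_sub_cancel] at h1 h2
  exact h (k - v) (by omega) (by omega)

theorem DDFree.mirror {x : Code} (h : DDFree x) (k : ℤ) : UUFree (GNC.mirror k x) := by
  intro v h1 h2
  simp only [GNC.mirror, sub_sub_cancel] at h1 h2
  exact h (k - v) (by omega) (by omega)

theorem image_mirror_uuFree (a b r k : ℤ) :
    mirror k '' codes UUFree a b r = codes DDFree (k - b) (k - a) (k - r) := by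
  ext x
  constructor
  · rintro ⟨y, ⟨hy, qy⟩, rfl⟩
    exact ⟨hy.mirror k, qy.mirror k⟩
  · rintro ⟨hx, qx⟩
    refine ⟨mirror k x, ⟨?_, qx.mirror k⟩, mirror_mirror k x⟩
    simpa using hx.mirror k

theorem ncard_mirror {a b r a' b' r' : ℤ} (k : ℤ) (ha : a' = k - b) (hb : b' = k - a)
    (hr : r' = k - r) : (codes DDFree a' b' r').ncard = (codes UUFree a b r).ncard := by
  rw [ha, hb, hr, ← image_mirror_uuFree,
    Set.ncard_image_of_injective _ (Function.LeftInverse.injective (mirror_mirror k))]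

/-- The number of codes on `n + 1` vertices in which no two ascents follow each other. -/
noncomputable def uuCount (n : ℕ) : ℕ := (codes UUFree 0 n 0).ncard

/-- The number of codes on `n + 1` vertices in which no two descents follow each other. -/
noncomputable def ddCount (n : ℕ) : ℕ := (codes DDFree 0 n 0).ncard

theorem ncard_dd_last {a b : ℤ} {n : ℕ} (h : b = a + n) :
    (codes DDFree a b b).ncard = uuCount n :=
  ncard_mirror b (by omega) (by omega) (by omega)

theorem ncard_uu_last {a b : ℤ} {n : ℕ} (h : b = a + n) :
    (codes UUFree a b b).ncard = ddCount n :=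
  (ncard_mirror b (by omega) (by omega) (by omega)).symm

/-- Two reflections compose to a translation, so the count depends only on the length of the
interval. -/
theorem ncard_uu_first {a b : ℤ} {n : ℕ} (h : b = a + n) :
    (codes UUFree a b a).ncard = uuCount n := by
  rw [← ncard_dd_last (a := 0) (b := n) (by omega)]
  exact (ncard_mirror b (by omega) (by omega) (by omega)).symm

theorem ncard_dd_first {a b : ℤ} {n : ℕ} (h : b = a + n) :
    (codes DDFree a b a).ncard = ddCount n := by
  rw [← ncard_uu_last (a := 0) (b := n) (by omega)]
  exact ncard_mirror b (by omega) (by omega) (by omega)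

/-- The code of the tree with the single vertex `a`. -/
theorem isCode_single (a : ℤ) : IsCode a a a (fun v => v, ∅) where
  fix _ _ := rfl
  root := rfl
  maps _ h h' := ⟨h, h'⟩
  reach S hS _ v h h' := by rwa [le_antisymm h' h]
  cross s t u v h1 h2 h3 h4 _ := by simp only at h4; omega
  gaps _ h := h.elim
  up v h := (lt_irrefl v h).elim
  down v h := (lt_irrefl v h).elim

theorem codes_single {Q : Code → Prop} (a : ℤ) (hQ : Q (fun v => v, ∅)) :
    (codes Q a a a).ncard = 1 := by
  rw [Set.ncard_eq_one]
  refine ⟨(fun v => v, ∅), Set.eq_singleton_iff_unique_mem.2 ⟨⟨isCode_single a, hQ⟩, ?_⟩⟩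
  rintro x ⟨hx, -⟩
  refine Prod.ext (funext fun v => ?_) (Set.eq_empty_of_forall_notMem fun g hg => ?_)
  · rcases eq_or_ne v a with rfl | hv
    · exact hx.root
    · exact hx.fix v (by omega)
  · have := hx.gaps g hg
    omega

/-! ### The recurrences -/

theorem uuCount_zero : uuCount 0 = 1 :=
  codes_single 0 fun _ h => absurd h (lt_irrefl _)

theorem ddCount_zero : ddCount 0 = 1 :=
  codes_single 0 fun _ h => absurd h (lt_irrefl _)

/-- The left and right parts have their root first. The middle part has it last, and reflection
turns it into a code counted by `uuCount`. -/
theorem ddCount_succ (n : ℕ) : ddCount (n + 1) = ∑ s ∈ Finset.HasAntidiagonal.antidiagonal n,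
    (∑ t ∈ Finset.HasAntidiagonal.antidiagonal s.1,
      (if t.1 = 0 ∧ t.2 = 0 then 1 else 2) * (ddCount t.1 * uuCount t.2)) * ddCount s.2 := by
  have h := ncard_codes_eq_sum DDFree 0 n
  rw [ncard_dd_first rfl, Finset.sum_sigma] at h
  rw [h]
  refine Finset.sum_congr rfl fun s hs => ?_
  rw [Finset.sum_mul]
  refine Finset.sum_congr rfl fun t ht => ?_
  rw [Finset.HasAntidiagonal.mem_antidiagonal] at hs ht
  dsimp only
  rw [ncard_split (by omega) (by omega) (by omega) fun x hx sx => ddFree_parts hx sx,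
    ncard_dd_first rfl, ncard_dd_last rfl, ncard_dd_first (n := s.2) (by omega)]
  have hif : ((0 : ℤ) + t.1 = 0 ∧ (0 : ℤ) + t.1 + 1 + t.2 = 0 + t.1 + 1) ↔ t.1 = 0 ∧ t.2 = 0 := by
    omega
  simp only [hif]

theorem uuCount_succ (n : ℕ) : uuCount (n + 1) = ∑ t ∈ Finset.HasAntidiagonal.antidiagonal n,
    (if t.1 = 0 ∧ t.2 = 0 then 1 else 2) * (uuCount t.1 * ddCount t.2) := by
  have h := ncard_codes_eq_sum UUFree 0 n
  rw [ncard_uu_first rfl, Finset.sum_sigma] at h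
  -- Only an empty right part contributes, because c = b.
  rw [h, Finset.sum_eq_single_of_mem (n, 0) (by simp)]
  · refine Finset.sum_congr rfl fun t ht => ?_
    rw [Finset.HasAntidiagonal.mem_antidiagonal] at ht
    dsimp only
    rw [ncard_split (Q₁ := UUFree) (Q₂ := UUFree) (Q₃ := fun _ => True) (by omega) (by omega) (by omega) fun x hx sx => by
        rw [uuFree_parts hx sx]
        have : (0 : ℤ) + t.1 + 1 + t.2 = 0 + (n + 1 : ℕ) := by omega
        simp only [this],
      ncard_uu_first rfl, ncard_uu_last rfl]
    have hif : ((0 : ℤ) + t.1 = 0 ∧ (0 : ℤ) + t.1 + 1 + t.2 = 0 + t.1 + 1) ↔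
        t.1 = 0 ∧ t.2 = 0 := by omega
    have hc : (0 : ℤ) + t.1 + 1 + t.2 = 0 + (n + 1 : ℕ) := by omega
    have h1 : (codes (fun _ => True) ((0 : ℤ) + t.1 + 1 + t.2) (0 + (n + 1 : ℕ))
        (0 + t.1 + 1 + t.2)).ncard = 1 := by
      rw [hc]
      exact codes_single _ trivial
    simp only [hif, h1, mul_one]
  · intro s hs hne
    refine Finset.sum_eq_zero fun t ht => ?_
    rw [Finset.HasAntidiagonal.mem_antidiagonal] at hs ht
    have hs2 : s.2 ≠ 0 := fun h => hne (Prod.ext (by simp only; omega) h)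
    rw [Set.ncard_eq_zero ((codes_finite _ _ _ _).subset fun x hx => hx.1)]
    refine Set.eq_empty_of_forall_notMem ?_
    rintro x ⟨hx, sx⟩
    have := ((uuFree_parts hx.1 sx).1 hx.2).2.2
    dsimp only at this
    omega

end GNC

/-! ### Power series and the Catalan numbers -/

namespace GNC

open PowerSeries

/-- The difference of the two equations factors, and the cofactor of A - B has constant coefficient
1. -/
theorem quadratic_unique {α A B : ℤ⟦X⟧} (u : ℤ⟦X⟧) (hA : A = α + u * X * A + 4 * X * A ^ 2)
    (hB : B = α + u * X * B + 4 * X * B ^ 2) : A = B := by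
  have h : (A - B) * (1 - X * (u + 4 * (A + B))) = 0 := by linear_combination hA - hB
  rcases mul_eq_zero.1 h with h | h
  · exact sub_eq_zero.1 h
  · have := congrArg constantCoeff h
    simp at this

/-- The generating function of the Catalan numbers, over the integers. -/
noncomputable def catalanInt : ℤ⟦X⟧ := PowerSeries.map (Nat.castRingHom ℤ) catalanSeries

theorem catalanInt_eq : catalanInt = 1 + X * catalanInt ^ 2 := by
  have h := congrArg (PowerSeries.map (Nat.castRingHom ℤ)) catalanSeries_sq_mul_X_add_one
  rw [map_add, map_mul, map_pow, map_one, map_X] at h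
  change catalanInt ^ 2 * X + 1 = catalanInt at h
  linear_combination -h

theorem coeff_catalanInt (n : ℕ) : coeff n catalanInt = (catalan n : ℤ) := by
  simp [catalanInt]

theorem subst_catalanInt {w : ℤ⟦X⟧} (hw : constantCoeff w = 0) :
    catalanInt.subst w = 1 + w * (catalanInt.subst w) ^ 2 := by
  have h := HasSubst.of_constantCoeff_zero' hw
  have h1 := congrArg (substAlgHom (R := ℤ) h) catalanInt_eq
  rw [map_add, map_mul, map_pow, map_one, substAlgHom_X] at h1
  rwa [coe_substAlgHom] at h1

/-- The kth power of `X * w` is divisible by `X ^ k`, so only the terms with k ≤ n reach the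
coefficient of index n. -/
theorem coeff_mul_subst_catalanInt {v w : ℤ⟦X⟧} (n : ℕ) :
    coeff n (v * catalanInt.subst (X * w)) =
      ∑ k ∈ Finset.range (n + 1), (catalan k : ℤ) * coeff (n - k) (v * w ^ k) := by
  have hw : constantCoeff (X * w) = 0 := by simp
  have hsub : ∀ m ≤ n, coeff m (catalanInt.subst (X * w)) =
      coeff m (∑ k ∈ Finset.range (n + 1), C (catalan k : ℤ) * (X * w) ^ k) := by
    intro m hm
    rw [coeff_subst' (HasSubst.of_constantCoeff_zero' hw), map_sum,
      finsum_eq_sum_of_support_subset]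
    · refine Finset.sum_congr rfl fun k _ => ?_
      rw [coeff_catalanInt, coeff_C_mul, smul_eq_mul]
    · intro k hk
      by_contra hcon
      apply hk
      simp only [Finset.coe_range, Set.mem_Iio, not_lt] at hcon
      change _ • coeff m ((X * w) ^ k) = 0
      rw [mul_pow, coeff_X_pow_mul', if_neg (by omega), smul_zero]
  have h1 : coeff n (v * catalanInt.subst (X * w)) =
      coeff n (v * ∑ k ∈ Finset.range (n + 1), C (catalan k : ℤ) * (X * w) ^ k) := by
    rw [coeff_mul, coeff_mul]
    refine Finset.sum_congr rfl fun t ht => ?_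
    rw [hsub t.2 (by have := Finset.HasAntidiagonal.mem_antidiagonal.1 ht; omega)]
  rw [h1, Finset.mul_sum, map_sum]
  refine Finset.sum_congr rfl fun k hk => ?_
  have : v * (C (catalan k : ℤ) * (X * w) ^ k) = C (catalan k : ℤ) * (X ^ k * (v * w ^ k)) := by
    ring
  rw [this, coeff_C_mul, coeff_X_pow_mul', if_pos (by have := Finset.mem_range.1 hk; omega)]

/-- The power series of `(1 - r X)⁻¹`. -/
noncomputable def geom (r : ℤ) : ℤ⟦X⟧ := PowerSeries.mk fun n => r ^ n

theorem geom_mul (r : ℤ) : geom r * (1 - C r * X) = 1 := by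
  have h := congrArg (rescale r) (mk_one_mul_one_sub_eq_one ℤ)
  rw [map_mul, map_sub, map_one, rescale_X] at h
  convert h using 2
  ext n
  simp [geom]

theorem coeff_geom_pow (r : ℤ) (d n : ℕ) :
    coeff n (geom r ^ (d + 1)) = ((d + n).choose d : ℤ) * r ^ n := by
  have h := congrArg (rescale r) (mk_add_choose_mul_one_sub_pow_eq_one ℤ d)
  rw [map_mul, map_pow, map_sub, map_one, rescale_X] at h
  have h2 : geom r ^ (d + 1) = rescale r (mk fun n => ((d + n).choose d : ℤ)) := by
    calc geom r ^ (d + 1) = geom r ^ (d + 1) *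
          (rescale r (mk fun n => ((d + n).choose d : ℤ)) * (1 - C r * X) ^ (d + 1)) := by
          rw [h, mul_one]
      _ = (geom r * (1 - C r * X)) ^ (d + 1) *
          rescale r (mk fun n => ((d + n).choose d : ℤ)) := by
          rw [mul_pow]; ring
      _ = _ := by rw [geom_mul, one_pow, one_mul]
  rw [h2, coeff_rescale, coeff_mk, mul_comm]

/-- The solution of `L = 1 - 3 X L + 4 X L ^ 2`. -/
theorem coeff_of_quadratic_one {L : ℤ⟦X⟧} (hL : L = 1 - 3 * X * L + 4 * X * L ^ 2) (n : ℕ) :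
    coeff n L = ∑ j ∈ Finset.range (n + 1),
      (-1 : ℤ) ^ j * ((2 * n - j).choose j : ℤ) * 3 ^ j * 4 ^ (n - j) * (catalan (n - j) : ℤ) := by
  have hq : geom (-3) * (1 + 3 * X) = 1 := by
    have h3 : (C (3 : ℤ) : ℤ⟦X⟧) = 3 := rfl
    have := geom_mul (-3)
    rwa [map_neg, h3, neg_mul, sub_neg_eq_add] at this
  have hs := subst_catalanInt (w := X * (4 * geom (-3) ^ 2)) (by simp)
  set c := catalanInt.subst (X * (4 * geom (-3) ^ 2)) with hc
  -- With g = 1/(1 + 3X), the equation reads L = g + 4XgL²; putting L = gc turns it into c = 1 +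
  -- 4Xg²c², the Catalan equation at 4Xg².
  have hM : L = geom (-3) * c := by
    refine quadratic_unique (α := 1) (-3) (by linear_combination hL) ?_
    linear_combination c * hq + hs
  rw [hM, hc, coeff_mul_subst_catalanInt, ← Finset.sum_range_reflect]
  refine Finset.sum_congr rfl fun j hj => ?_
  have hj' : j ≤ n := by have := Finset.mem_range.1 hj; omega
  have e1 : n + 1 - 1 - j = n - j := by omega
  have e2 : n - (n - j) = j := by omega
  have e3 : geom (-3) * (4 * geom (-3) ^ 2) ^ (n - j) =
      C ((4 : ℤ) ^ (n - j)) * geom (-3) ^ (2 * (n - j) + 1) := by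
    rw [mul_pow, ← pow_mul, pow_succ, map_pow]
    have : (C (4 : ℤ) : ℤ⟦X⟧) = 4 := rfl
    rw [this]
    ring
  have e4 : 2 * (n - j) + j = 2 * n - j := by omega
  have e5 : (2 * n - j).choose (2 * (n - j)) = (2 * n - j).choose j := by
    rw [← Nat.choose_symm_of_eq_add (show 2 * n - j = j + 2 * (n - j) by omega)]
  rw [e1, e2, e3, coeff_C_mul, coeff_geom_pow, e4, e5, neg_pow (3 : ℤ)]
  ring

/-- The solution of `G = X + 3 X G + G ^ 2` without constant coefficient. -/
theorem coeff_of_quadratic_two {G : ℤ⟦X⟧} (h0 : constantCoeff G = 0)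
    (hG : G = X + 3 * X * G + G ^ 2) (n : ℕ) :
    coeff (n + 2) G = ∑ i ∈ Finset.range (n + 1),
      (n.choose i : ℤ) * 2 ^ (i + 2) * (catalan (i + 1) : ℤ) := by
  have hq : geom 1 * (1 - X) = 1 := by
    have := geom_mul 1
    rwa [map_one, one_mul] at this
  have hs := subst_catalanInt (w := X * (2 * geom 1)) (by simp)
  set c := catalanInt.subst (X * (2 * geom 1)) with hc
  -- The discriminant (1 - 3X)² - 4X = (1 - X)(1 - 9X) equals (1 - X)²(1 - 4w) for w = 2X/(1 - X),
  -- so the root without constant coefficient is expressed by the Catalan series at w.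
  have hM : G = X * (2 * c - 1) := by
    have hM' : X * (2 * c - 1) = X + 3 * X * (X * (2 * c - 1)) + (X * (2 * c - 1)) ^ 2 := by
      linear_combination 2 * X * (1 - X) * hs + 4 * X ^ 2 * c ^ 2 * hq
    have h : (G - X * (2 * c - 1)) * (1 - (3 * X + G + X * (2 * c - 1))) = 0 := by
      linear_combination hG - hM'
    rcases mul_eq_zero.1 h with h | h
    · exact sub_eq_zero.1 h
    · have := congrArg constantCoeff h
      simp [h0] at this
  rw [hM, coeff_succ_X_mul, map_sub, coeff_one, if_neg (by omega), sub_zero, hc,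
    coeff_mul_subst_catalanInt, Finset.sum_range_succ']
  -- The Catalan term of index 0 is a constant and does not contribute; the others are shifted to k
  -- = i + 1.
  have hz : coeff (n + 1 - 0) ((2 : ℤ⟦X⟧) * (2 * geom 1) ^ 0) = 0 := by
    rw [pow_zero, mul_one]
    exact coeff_C_of_ne_zero (a := (2 : ℤ)) (by omega)
  rw [hz, mul_zero, add_zero]
  refine Finset.sum_congr rfl fun i hi => ?_
  have hi' : i ≤ n := by have := Finset.mem_range.1 hi; omega
  have e1 : (2 : ℤ⟦X⟧) * (2 * geom 1) ^ (i + 1) = C ((2 : ℤ) ^ (i + 2)) * geom 1 ^ (i + 1) := by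
    rw [mul_pow, map_pow]
    have : (C (2 : ℤ) : ℤ⟦X⟧) = 2 := rfl
    rw [this]
    ring
  have e2 : i + (n + 1 - (i + 1)) = n := by omega
  rw [e1, coeff_C_mul, coeff_geom_pow, e2, one_pow]
  ring

theorem coeff_of_recurrence {f l : ℕ → ℕ} (hf0 : f 0 = 1) (hl0 : l 0 = 1)
    (hf : ∀ n, f (n + 1) = ∑ t ∈ Finset.HasAntidiagonal.antidiagonal n,
      (if t.1 = 0 ∧ t.2 = 0 then 1 else 2) * (f t.1 * l t.2))
    (hl : ∀ n, l (n + 1) = ∑ s ∈ Finset.HasAntidiagonal.antidiagonal n,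
      (∑ t ∈ Finset.HasAntidiagonal.antidiagonal s.1,
        (if t.1 = 0 ∧ t.2 = 0 then 1 else 2) * (l t.1 * f t.2)) * l s.2) :
    (∀ n, f (n + 2) = ∑ i ∈ Finset.range (n + 1),
      n.choose i * 2 ^ (i + 2) * catalan (i + 1)) ∧
    ∀ n, (l n : ℤ) = ∑ j ∈ Finset.range (n + 1),
      (-1 : ℤ) ^ j * ((2 * n - j).choose j : ℤ) * 3 ^ j * 4 ^ (n - j) *
        (catalan (n - j) : ℤ) := by
  set F : ℤ⟦X⟧ := mk fun n => (f n : ℤ) with hF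
  set L : ℤ⟦X⟧ := mk fun n => (l n : ℤ) with hL
  -- The weight is symmetric, so the inner sum is the one in the recurrence for f.
  have hl' : ∀ n, l (n + 1) = ∑ s ∈ Finset.HasAntidiagonal.antidiagonal n, f (s.1 + 1) * l s.2 := by
    intro n
    rw [hl]
    refine Finset.sum_congr rfl fun s _ => ?_
    rw [hf, ← Finset.Nat.sum_antidiagonal_swap]
    simp only [Prod.fst_swap, Prod.snd_swap]
    congr 1
    refine Finset.sum_congr rfl fun t _ => ?_
    simp only [and_comm, mul_comm]
  -- The - 1 corrects the weight of the pair (0, 0) from 2 to 1.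
  have hK : ∀ n, (f (n + 1) : ℤ) = coeff n (2 * (F * L) - 1) := by
    intro n
    have h2 : (2 : ℤ⟦X⟧) = C (2 : ℤ) := rfl
    rw [hf, map_sub, h2, coeff_C_mul, coeff_mul, coeff_one, Finset.mul_sum]
    simp only [hF, hL, coeff_mk]
    rcases Nat.eq_zero_or_pos n with rfl | hn
    · simp [hf0, hl0]
    · rw [if_neg (by omega), sub_zero]
      push_cast
      refine Finset.sum_congr rfl fun t ht => ?_
      have := Finset.HasAntidiagonal.mem_antidiagonal.1 ht
      rw [if_neg (by omega)]
  have hFe : F = 1 + X * (2 * (F * L) - 1) := by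
    ext n
    cases n with
    | zero => simp [hF, hf0]
    | succ n =>
      rw [map_add, coeff_succ_X_mul, ← hK, coeff_one, if_neg (by omega), zero_add, hF, coeff_mk]
  have hLe : L = 1 + X * ((2 * (F * L) - 1) * L) := by
    ext n
    cases n with
    | zero => simp [hL, hl0]
    | succ n =>
      rw [map_add, coeff_succ_X_mul, coeff_mul, coeff_one, if_neg (by omega), zero_add]
      simp only [← hK]
      simp only [hL, coeff_mk]
      rw [hl']
      push_cast
      rfl
  have hFL : F * L = 2 * L - 1 := by linear_combination L * hFe - hLe
  constructor
  · intro n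
    have h := coeff_of_quadratic_two (G := F - 1) (by simp [hF, hf0]) (by
      have hL0 : L ≠ 0 := by
        intro h
        have := congrArg constantCoeff h
        simp [hL, hl0] at this
      apply mul_left_cancel₀ hL0
      linear_combination hFe - (X + (F - 1)) * hFL) n
    rw [map_sub, coeff_one, if_neg (by omega), sub_zero, hF, coeff_mk] at h
    exact_mod_cast h
  · intro n
    have h := coeff_of_quadratic_one (L := L) (by linear_combination hLe + 2 * X * L * hFL) n
    rw [hL, coeff_mk] at h
    exact h

end GNC

/-! ### Parent functions of trees -/

namespace GNC

/-- `p` maps every vertex of the tree `G` with root `0` to its parent, and the root to itself. -/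
structure IsParent {n : ℕ} (G : SimpleGraph (Fin (n + 1))) (p : Fin (n + 1) → Fin (n + 1)) :
    Prop where
  root : p 0 = 0
  adj : ∀ v w, G.Adj v w ↔ v ≠ w ∧ (p v = w ∨ p w = v)
  reach : ∀ S : Set (Fin (n + 1)), 0 ∈ S → (∀ v, p v ∈ S → v ∈ S) → ∀ v, v ∈ S

variable {n : ℕ} {G : SimpleGraph (Fin (n + 1))} {p : Fin (n + 1) → Fin (n + 1)}

/-- The parent of v is the second vertex of the path from v to 0; the empty path has second vertex
0, so the root is fixed. For adjacent v and w, either v lies on the path of w, and is then its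
second vertex, or prepending v gives the path of v. -/
theorem exists_isParent (hG : G.IsTree) : ∃ p, IsParent G p := by
  choose q hq hq' using fun v => hG.existsUnique_path v 0
  have hcons : ∀ {v w : Fin (n + 1)} (h : G.Adj v w) (r : G.Walk w 0),
      (SimpleGraph.Walk.cons h r).IsPath → (q v).snd = w := by
    intro v w h r hr
    rw [← hq' v _ hr, SimpleGraph.Walk.snd_cons]
  have hroot : (q 0).snd = 0 := by
    rw [← hq' 0 SimpleGraph.Walk.nil SimpleGraph.Walk.IsPath.nil]
    rfl
  refine ⟨fun v => (q v).snd, hroot, ?_, ?_⟩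
  · have hadj : ∀ v w, v ≠ w → (q v).snd = w → G.Adj v w := by
      intro v w hvw h
      rw [← h]
      refine SimpleGraph.Walk.adj_snd (SimpleGraph.Walk.not_nil_of_ne ?_)
      rintro rfl
      exact hvw (hroot.symm.trans h)
    intro v w
    constructor
    · intro h
      refine ⟨h.ne, ?_⟩
      by_cases hv : v ∈ (q w).support
      · exact Or.inr (hG.isAcyclic.eq_snd_of_adj_start (hq w) h.symm hv).symm
      · exact Or.inl (hcons h _ ((SimpleGraph.Walk.cons_isPath_iff _ _).2 ⟨hq w, hv⟩))
    · rintro ⟨hne, h | h⟩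
      · exact hadj v w hne h
      · exact (hadj w v hne.symm h).symm
  · intro S hS hcl v
    have key : ∀ {v z : Fin (n + 1)} (r : G.Walk v z), z = 0 → r.IsPath → v ∈ S := by
      intro v z r
      induction r with
      | nil => rintro rfl _; exact hS
      | cons h r ih =>
        rintro rfl hr
        apply hcl
        rw [hcons h r hr]
        exact ih rfl hr.of_cons
    exact key (q v) rfl (hq v)

namespace IsParent

/-- Applied to complements, `reach` says that a nonempty set closed under p contains 0. This
excludes fixed points and 2-cycles away from the root. -/
theorem ne_self (h : IsParent G p) {v : Fin (n + 1)} (hv : v ≠ 0) : p v ≠ v := fun hp =>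
  h.reach {w | w ≠ v} hv.symm (fun w hw hwv => hw (by rw [hwv, hp])) v rfl

theorem no_two_cycle (h : IsParent G p) {v w : Fin (n + 1)} (hv : v ≠ 0) (hw : p v = w) :
    p w ≠ v := by
  intro hp
  have hw0 : w ≠ 0 := by
    rintro rfl
    exact hv (hp.symm.trans h.root)
  refine h.reach {u | u ≠ v ∧ u ≠ w} ⟨hv.symm, hw0.symm⟩ ?_ v |>.1 rfl
  rintro u ⟨h1, h2⟩
  refine ⟨?_, ?_⟩
  · rintro rfl
    exact h2 hw
  · rintro rfl
    exact h1 hp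

theorem unique (h : IsParent G p) {q : Fin (n + 1) → Fin (n + 1)} (hq : IsParent G q) : p = q := by
  funext v
  refine h.reach {v | p v = q v} (h.root.trans hq.root.symm) (fun v hv => ?_) v
  change p (p v) = q (p v) at hv
  by_contra hne
  have hne' : p v ≠ q v := hne
  have hv0 : v ≠ 0 := by
    rintro rfl
    exact hne' (h.root.trans hq.root.symm)
  have hadj : G.Adj v (p v) := (h.adj _ _).2 ⟨(h.ne_self hv0).symm, Or.inl rfl⟩
  have hqv : q (p v) = v := ((hq.adj _ _).1 hadj).2.resolve_left (Ne.symm hne')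
  exact h.no_two_cycle hv0 rfl (hv.trans hqv)

/-- The graph is connected, and each edge joins some v ≠ 0 to its parent, so there are at most n
edges. -/
theorem isTree (h : IsParent G p) : G.IsTree := by
  have hreach : ∀ v, G.Reachable v 0 := by
    refine h.reach {v | G.Reachable v 0} (SimpleGraph.Reachable.refl 0) fun v hv => ?_
    by_cases hp : p v = v
    · rwa [hp] at hv
    · exact SimpleGraph.Reachable.trans
        ((h.adj v (p v)).2 ⟨Ne.symm hp, Or.inl rfl⟩).reachable hv
  have hconn : G.Connected := ⟨fun v w => (hreach v).trans (hreach w).symm⟩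
  rw [SimpleGraph.isTree_iff_connected_and_card]
  refine ⟨hconn, le_antisymm ?_ hconn.card_vert_le_card_edgeSet_add_one⟩
  have hsub : G.edgeSet ⊆ (fun v => s(v, p v)) '' {v | v ≠ 0} := by
    intro e
    induction e using Sym2.ind with
    | _ v w =>
      intro he
      obtain ⟨hne, he | he⟩ := (h.adj v w).1 he
      · refine ⟨v, ?_, by simp only [he]⟩
        rintro rfl
        exact hne (h.root.symm.trans he)
      · refine ⟨w, ?_, by simp only [he]; exact Sym2.eq_swap⟩
        rintro rfl
        exact hne (he.symm.trans h.root)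
  have h1 := (Set.ncard_le_ncard hsub).trans (Set.ncard_image_le (Set.toFinite _))
  have h2 : ({v | v ≠ 0} : Set (Fin (n + 1))).ncard = n := by
    have : ({v | v ≠ 0} : Set (Fin (n + 1))) = {0}ᶜ := by ext; simp
    rw [this, Set.ncard_compl]
    simp
  rw [h2] at h1
  rw [Nat.card_coe_set_eq, Nat.card_fin]
  omega

/-- A path whose first step does not go to the parent never goes to a parent later, since that would
revisit a vertex. The hypothesis on u is the form that survives the induction. -/
theorem darts (h : IsParent G p) {u v : Fin (n + 1)} (q : G.Walk u v) (hq : q.IsPath)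
    (hu : p u ∉ q.support ∨ u = 0) : ∀ d ∈ q.darts, p d.snd = d.fst := by
  induction q with
  | nil => simp
  | @cons u w v hadj r ih =>
    rw [SimpleGraph.Walk.cons_isPath_iff] at hq
    have hne := ((h.adj u w).1 hadj).1
    have hpw : p w = u := by
      refine ((h.adj u w).1 hadj).2.resolve_left fun hpu => ?_
      rcases hu with hu | rfl
      · apply hu
        rw [hpu]
        simp
      · exact hne (h.root.symm.trans hpu)
    intro d hd
    rw [SimpleGraph.Walk.darts_cons, List.mem_cons] at hd
    rcases hd with rfl | hd
    · exact hpw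
    · exact ih hq.1 (Or.inl (hpw ▸ hq.2)) d hd

theorem exists_walk (h : IsParent G p) (v : Fin (n + 1)) : ∃ q : G.Walk 0 v, q.IsPath :=
  (h.isTree.existsUnique_path 0 v).exists

theorem exists_concat (h : IsParent G p) {u v : Fin (n + 1)} (hu : u = 0) (hv : v ≠ 0)
    (q : G.Walk u v) (hq : q.IsPath) :
    ∃ (r : G.Walk u (p v)) (ha : G.Adj (p v) v), r.IsPath ∧ q = r.concat ha := by
  have hd := h.darts q hq (Or.inr hu)
  cases q with
  | nil => exact absurd hu hv
  | cons h' q' =>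
    obtain ⟨x, r, ha, hr⟩ := SimpleGraph.Walk.exists_cons_eq_concat h' q'
    rw [hr] at hd hq ⊢
    have hx : p v = x := hd ⟨(x, v), ha⟩ (by simp [SimpleGraph.Walk.darts_concat])
    subst hx
    exact ⟨r, ha, ((SimpleGraph.Walk.concat_isPath_iff ha).1 hq).1, rfl⟩

end IsParent

/-! ### Patterns in terms of the parent function -/

namespace Tree

variable {T : Tree n}

theorem contains_singleton (h : IsParent T.graph p) (s : Step) :
    T.Contains [s] ↔ ∃ v, v ≠ 0 ∧ stepOf (T.label (p v)) (T.label v) = s := by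
  constructor
  · rintro ⟨v, q, hq, hs⟩
    rw [List.singleton_infix_iff, word, List.mem_map] at hs
    obtain ⟨d, hd, hs⟩ := hs
    have hpd := h.darts q hq (Or.inr rfl) d hd
    refine ⟨d.snd, ?_, by rw [hpd, hs]⟩
    intro h0
    rw [h0, h.root] at hpd
    exact d.adj.ne (hpd.symm.trans h0.symm)
  · rintro ⟨v, hv, hs⟩
    obtain ⟨q, hq⟩ := h.exists_walk v
    obtain ⟨r, ha, -, rfl⟩ := h.exists_concat rfl hv q hq
    refine ⟨v, r.concat ha, hq, ?_⟩
    change [s] <:+: List.map _ (r.concat ha).darts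
    rw [List.singleton_infix_iff, SimpleGraph.Walk.darts_concat]
    simp [hs]

theorem contains_pair (h : IsParent T.graph p) (s t : Step) :
    T.Contains [s, t] ↔ ∃ v, v ≠ 0 ∧ p v ≠ 0 ∧
      stepOf (T.label (p (p v))) (T.label (p v)) = s ∧ stepOf (T.label (p v)) (T.label v) = t := by
  constructor
  · rintro ⟨v, q, hq, hs⟩
    rw [word, List.infix_map_iff] at hs
    obtain ⟨l, hl, hst⟩ := hs
    obtain ⟨d, e, rfl⟩ : ∃ d e, l = [d, e] := by
      rw [← List.length_eq_two, ← List.length_map, ← hst]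
      rfl
    simp only [List.map_cons, List.map_nil, List.cons.injEq, and_true] at hst
    have hpd := h.darts q hq (Or.inr rfl) d (hl.subset (by simp))
    have hpe := h.darts q hq (Or.inr rfl) e (hl.subset (by simp))
    have hde : d.snd = e.fst := by
      have := (SimpleGraph.Walk.isChain_dartAdj_darts q).infix hl
      simpa [SimpleGraph.DartAdj] using this
    have hne : ∀ d : T.graph.Dart, p d.snd = d.fst → d.snd ≠ 0 := by
      intro d hd h0
      rw [h0, h.root] at hd
      exact d.adj.ne (hd.symm.trans h0.symm)
    refine ⟨e.snd, hne e hpe, ?_, ?_, ?_⟩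
    · rw [hpe, ← hde]
      exact hne d hpd
    · rw [hpe, ← hde, hpd, hst.1]
    · rw [hpe, hst.2]
  · rintro ⟨v, hv, hpv, hs, ht⟩
    obtain ⟨q, hq⟩ := h.exists_walk v
    obtain ⟨r, ha, hr, rfl⟩ := h.exists_concat rfl hv q hq
    obtain ⟨r', ha', -, rfl⟩ := h.exists_concat rfl hpv r hr
    refine ⟨v, (r'.concat ha').concat ha, hq, ?_⟩
    change [s, t] <:+: List.map _ ((r'.concat ha').concat ha).darts
    rw [SimpleGraph.Walk.darts_concat, SimpleGraph.Walk.darts_concat]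
    refine ⟨r'.darts.map fun e => stepOf (T.label e.fst) (T.label e.snd), [], ?_⟩
    simp [hs, ht]

end Tree

theorem stepOf_eq_u {i j : ℕ} : stepOf i j = Step.u ↔ i < j := by
  unfold stepOf
  split_ifs <;> simp_all

theorem stepOf_eq_h {i j : ℕ} : stepOf i j = Step.h ↔ i = j := by
  unfold stepOf
  split_ifs <;> simp_all
  omega

theorem stepOf_eq_d {i j : ℕ} : stepOf i j = Step.d ↔ j < i := by
  unfold stepOf
  split_ifs <;> simp_all <;> omega

namespace Tree

variable {T : Tree n}

theorem lt_iff_label_lt {v w : Fin (n + 1)} (h : T.label v ≠ T.label w) :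
    T.label v < T.label w ↔ v < w := by
  constructor
  · intro h'
    by_contra hvw
    exact absurd (T.label_mono (not_lt.1 hvw)) (not_le.2 h')
  · intro h'
    exact lt_of_le_of_ne (T.label_mono h'.le) h

/-- Without level edges, comparing the labels of a vertex and its parent is comparing their
positions, so the pattern no longer involves the labels. -/
theorem mem_avoiding_uu (h : IsParent T.graph p) :
    T ∈ Avoiding n {[Step.u, Step.u], [Step.h]} ↔
      (∀ v, v ≠ 0 → T.label (p v) ≠ T.label v) ∧ ∀ v, p (p v) < p v → ¬ p v < v := by
  have h1 : T ∈ Avoiding n {[Step.u, Step.u], [Step.h]} ↔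
      ¬ T.Contains [Step.u, Step.u] ∧ ¬ T.Contains [Step.h] := by
    simp [Avoiding]
  rw [h1, contains_singleton h, contains_pair h, and_comm]
  simp only [stepOf_eq_u, stepOf_eq_h, not_exists, not_and]
  refine and_congr_right fun hlev => ⟨fun hp v h2 h3 => ?_, fun hp v hv hpv h2 h3 => ?_⟩
  · have hv := Fin.ne_zero_of_lt h3
    have hpv := Fin.ne_zero_of_lt h2
    exact hp v hv hpv ((lt_iff_label_lt (hlev _ hpv)).2 h2) ((lt_iff_label_lt (hlev _ hv)).2 h3)
  · exact hp v ((lt_iff_label_lt h2.ne).1 h2) ((lt_iff_label_lt h3.ne).1 h3)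

theorem mem_avoiding_dd (h : IsParent T.graph p) :
    T ∈ Avoiding n {[Step.d, Step.d], [Step.h]} ↔
      (∀ v, v ≠ 0 → T.label (p v) ≠ T.label v) ∧ ∀ v, p v < p (p v) → ¬ v < p v := by
  have h1 : T ∈ Avoiding n {[Step.d, Step.d], [Step.h]} ↔
      ¬ T.Contains [Step.d, Step.d] ∧ ¬ T.Contains [Step.h] := by
    simp [Avoiding]
  rw [h1, contains_singleton h, contains_pair h, and_comm]
  simp only [stepOf_eq_d, stepOf_eq_h, not_exists, not_and]
  refine and_congr_right fun hlev => ⟨fun hp v h2 h3 => ?_, fun hp v hv hpv h2 h3 => ?_⟩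
  · have hpv : p v ≠ 0 := by
      intro h0
      rw [h0, h.root] at h2
      exact lt_irrefl _ h2
    have hv : v ≠ 0 := by
      rintro rfl
      exact hpv h.root
    exact hp v hv hpv ((lt_iff_label_lt (Ne.symm (hlev _ hpv))).2 h2)
      ((lt_iff_label_lt (Ne.symm (hlev _ hv))).2 h3)
  · exact hp v ((lt_iff_label_lt h2.ne).1 h2) ((lt_iff_label_lt h3.ne).1 h3)

/-! ### The correspondence between trees and codes -/

/-- A label that is larger than an earlier one exceeds it somewhere in a single step. -/
theorem exists_jump (l : Fin (n + 1) → ℕ) {v w : Fin (n + 1)} (hvw : v ≤ w) (h : l v < l w) :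
    ∃ i : ℕ, ∃ hi : i + 1 < n + 1, (v : ℕ) ≤ i ∧ i < w ∧
      l ⟨i, by omega⟩ < l ⟨i + 1, hi⟩ := by
  by_contra hcon
  push Not at hcon
  have key : ∀ k : ℕ, ∀ hk : (v : ℕ) + k < n + 1, (v : ℕ) + k ≤ w → l ⟨v + k, hk⟩ ≤ l v := by
    intro k
    induction k with
    | zero => intro _ _; exact le_rfl
    | succ k ih =>
      intro hk hkw
      exact (hcon (v + k) hk (by omega) (by omega)).trans (ih (by omega) (by omega))
  have hvw' : (v : ℕ) ≤ w := hvw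
  have := key (w - v) (by omega) (by omega)
  have hw : (⟨v + (w - v), by omega⟩ : Fin (n + 1)) = w := Fin.ext (by simp only; omega)
  rw [hw] at this
  omega

theorem label_zero (T : Tree n) : T.label 0 = 1 := T.label_root

/-- If the label increases, then the next integer is a label; by monotonicity its vertex comes after
i, so the label at i + 1 is no larger. -/
theorem label_succ (T : Tree n) {i : ℕ} (hi : i + 1 < n + 1) :
    T.label ⟨i + 1, hi⟩ = T.label ⟨i, by omega⟩ ∨
      T.label ⟨i + 1, hi⟩ = T.label ⟨i, by omega⟩ + 1 := by
  have h1 : T.label ⟨i, by omega⟩ ≤ T.label ⟨i + 1, hi⟩ :=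
    T.label_mono (Fin.mk_le_mk.2 (by omega))
  rcases h1.eq_or_lt with h | h
  · exact Or.inl h.symm
  · obtain ⟨w, hw⟩ := T.label_initial ⟨i + 1, hi⟩ (T.label ⟨i, by omega⟩ + 1) (by omega) h
    rcases le_or_gt (w : ℕ) i with hwi | hwi
    · have : T.label w ≤ T.label ⟨i, by omega⟩ := T.label_mono (Fin.mk_le_mk.2 hwi)
      omega
    · have : T.label ⟨i + 1, hi⟩ ≤ T.label w := T.label_mono (Fin.mk_le_mk.2 hwi)
      right
      omega

/-- The code of a tree: its parent function, and the gaps at which the label increases. -/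
noncomputable def code (T : Tree n) : Code :=
  (fun z => if h : 0 ≤ z ∧ z ≤ n then
      ((exists_isParent T.isTree).choose ⟨z.toNat, by omega⟩ : ℕ) else z,
    {g | ∃ i : ℕ, ∃ hi : i + 1 < n + 1, g = i ∧ T.label ⟨i, by omega⟩ < T.label ⟨i + 1, hi⟩})

theorem code_fst (h : IsParent T.graph p) (v : Fin (n + 1)) :
    T.code.1 ((v : ℕ) : ℤ) = ((p v : ℕ) : ℤ) := by
  have hp : (exists_isParent T.isTree).choose = p := (exists_isParent T.isTree).choose_spec.unique h
  have hv : (0 : ℤ) ≤ (v : ℕ) ∧ ((v : ℕ) : ℤ) ≤ n := by omega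
  simp only [code, dif_pos hv, hp, Int.toNat_natCast, Fin.eta]

theorem code_fst_of_not_mem {z : ℤ} (hz : ¬ (0 ≤ z ∧ z ≤ n)) : T.code.1 z = z := dif_neg hz

theorem exists_fin {z : ℤ} (h : 0 ≤ z) (h' : z ≤ n) : ∃ v : Fin (n + 1), z = ((v : ℕ) : ℤ) :=
  ⟨⟨z.toNat, by omega⟩, by simp only; omega⟩

theorem isCode_code (h : IsParent T.graph p) (hlev : ∀ v, v ≠ 0 → T.label (p v) ≠ T.label v) :
    IsCode 0 n 0 T.code := by
  have hmem : ∀ z, T.code.1 z ≠ z → ∃ v : Fin (n + 1), z = ((v : ℕ) : ℤ) := by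
    intro z hz
    by_cases hz' : 0 ≤ z ∧ z ≤ n
    · exact exists_fin hz'.1 hz'.2
    · exact absurd (code_fst_of_not_mem hz') hz
  have hedge : ∀ s u : ℤ, s ≠ u → (T.code.1 s = u ∨ T.code.1 u = s) →
      ∃ v w : Fin (n + 1), s = ((v : ℕ) : ℤ) ∧ u = ((w : ℕ) : ℤ) ∧ T.graph.Adj v w := by
    rintro s u hsu (hs | hs)
    · obtain ⟨v, rfl⟩ := hmem s (by omega)
      rw [code_fst h] at hs
      refine ⟨v, p v, rfl, hs.symm, (h.adj _ _).2 ⟨?_, Or.inl rfl⟩⟩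
      intro hv
      exact hsu (by rw [← hs, ← hv])
    · obtain ⟨v, rfl⟩ := hmem u (by omega)
      rw [code_fst h] at hs
      refine ⟨p v, v, hs.symm, rfl, (h.adj _ _).2 ⟨?_, Or.inr rfl⟩⟩
      intro hv
      exact hsu (by rw [← hs, hv])
  have hroot : T.code.1 0 = 0 := by
    have := code_fst h 0
    rw [h.root] at this
    simpa using this
  have hne0 : ∀ v : Fin (n + 1), p v ≠ v → v ≠ 0 := by
    rintro v hv rfl
    exact hv h.root
  refine ⟨fun z hz => code_fst_of_not_mem (by omega), hroot, fun z h1 h2 => ?_,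
    fun S hS hcl z h1 h2 => ?_, fun s t u v h1 h2 h3 h4 h5 => ?_, ?_, fun z hz => ?_, fun z hz => ?_⟩
  · obtain ⟨v, rfl⟩ := exists_fin h1 h2
    rw [code_fst h]
    omega
  · obtain ⟨v, rfl⟩ := exists_fin h1 h2
    refine h.reach {v | ((v : ℕ) : ℤ) ∈ S} (by simpa using hS) (fun w hw => ?_) v
    apply hcl
    rw [code_fst h]
    exact hw
  · obtain ⟨s', u', rfl, rfl, hsu⟩ := hedge s u (by omega) h4
    obtain ⟨t', v', rfl, rfl, htv⟩ := hedge t v (by omega) h5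
    exact T.nonCrossing s' t' u' v' (Fin.lt_def.2 (by omega)) (Fin.lt_def.2 (by omega))
      (Fin.lt_def.2 (by omega)) ⟨hsu, htv⟩
  · rintro g ⟨i, hi, rfl, -⟩
    omega
  · obtain ⟨v, rfl⟩ := hmem z (by omega)
    rw [code_fst h] at hz ⊢
    have hlt : v < p v := Fin.lt_def.2 (by omega)
    have hl := (lt_iff_label_lt (hlev v (hne0 v hlt.ne')).symm).2 hlt
    obtain ⟨i, hi, h1, h2, h3⟩ := exists_jump T.label hlt.le hl
    exact ⟨i, ⟨i, hi, rfl, h3⟩, by omega, by omega⟩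
  · obtain ⟨v, rfl⟩ := hmem z (by omega)
    rw [code_fst h] at hz ⊢
    have hlt : p v < v := Fin.lt_def.2 (by omega)
    have hl := (lt_iff_label_lt (hlev v (hne0 v hlt.ne))).2 hlt
    obtain ⟨i, hi, h1, h2, h3⟩ := exists_jump T.label hlt.le hl
    exact ⟨i, ⟨i, hi, rfl, h3⟩, by omega, by omega⟩

/-- The parents determine the graph. The labels start at 1 and grow by 0 or 1, so the gaps determine
them. -/
theorem code_injective : Function.Injective (code (n := n)) := by
  intro S T hST
  obtain ⟨p, hp⟩ := exists_isParent S.isTree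
  obtain ⟨q, hq⟩ := exists_isParent T.isTree
  have hpq : p = q := by
    funext v
    have := code_fst hp v
    rw [hST, code_fst hq v] at this
    exact Fin.ext (by omega)
  subst hpq
  refine Tree.ext ?_ ?_
  · ext v w
    rw [hp.adj, hq.adj]
  · have hjump : ∀ i : ℕ, ∀ hi : i + 1 < n + 1,
        (S.label ⟨i, by omega⟩ < S.label ⟨i + 1, hi⟩ ↔
          T.label ⟨i, by omega⟩ < T.label ⟨i + 1, hi⟩) := by
      have key : ∀ {S T : Tree n}, S.code = T.code → ∀ i : ℕ, ∀ hi : i + 1 < n + 1,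
          S.label ⟨i, by omega⟩ < S.label ⟨i + 1, hi⟩ →
          T.label ⟨i, by omega⟩ < T.label ⟨i + 1, hi⟩ := by
        intro S T hST i hi h
        have h1 : (i : ℤ) ∈ S.code.2 := ⟨i, hi, rfl, h⟩
        rw [hST] at h1
        obtain ⟨j, hj, hij, h2⟩ := h1
        obtain rfl : i = j := by omega
        exact h2
      exact fun i hi => ⟨key hST i hi, key hST.symm i hi⟩
    have hlab : ∀ i : ℕ, ∀ hi : i < n + 1, S.label ⟨i, hi⟩ = T.label ⟨i, hi⟩ := by
      intro i
      induction i with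
      | zero => exact fun _ => S.label_zero.trans T.label_zero.symm
      | succ i ih =>
        intro hi
        have h1 := ih (by omega)
        have h2 := hjump i hi
        have h3 := S.label_succ hi
        have h4 := T.label_succ hi
        omega
    exact funext fun v => hlab v v.2

theorem exists_code_eq {x : Code} (hx : IsCode 0 n 0 x) :
    ∃ (T : Tree n) (p : Fin (n + 1) → Fin (n + 1)), T.code = x ∧ IsParent T.graph p ∧
      ∀ v, v ≠ 0 → T.label (p v) ≠ T.label v := by
  classical
  have hmaps : ∀ v : Fin (n + 1), 0 ≤ x.1 (v : ℕ) ∧ x.1 (v : ℕ) ≤ n := fun v =>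
    hx.maps (v : ℕ) (by omega) (by omega)
  set p : Fin (n + 1) → Fin (n + 1) := fun v =>
    ⟨(x.1 (v : ℕ)).toNat, by have := hmaps v; omega⟩ with hp
  have hpx : ∀ v, ((p v : ℕ) : ℤ) = x.1 (v : ℕ) := fun v => by
    have := hmaps v
    simp only [hp]
    omega
  let G : SimpleGraph (Fin (n + 1)) :=
    { Adj := fun v w => v ≠ w ∧ (p v = w ∨ p w = v)
      symm := ⟨fun v w h => ⟨h.1.symm, h.2.symm⟩⟩
      loopless := ⟨fun v h => h.1 rfl⟩ }
  have hG : IsParent G p := by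
    refine ⟨Fin.ext ?_, fun v w => Iff.rfl, fun S hS hcl v => ?_⟩
    · have := hpx 0
      have h0 := hx.root
      simp only [Fin.val_zero, Nat.cast_zero, h0] at this ⊢
      omega
    · have := hx.reach {z | ∀ w : Fin (n + 1), z = ((w : ℕ) : ℤ) → w ∈ S}
        (fun w hw => by
          have : w = 0 := Fin.ext (by simp only [Fin.val_zero]; omega)
          rwa [this])
        (fun z hz w hw => by
          subst hw
          exact hcl w (hz (p w) (hpx w).symm)) (v : ℕ) (by omega) (by omega)
      exact this v rfl
  -- The label of k is one more than the number of gaps of x before k.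
  let l : ℕ → ℕ := fun k => 1 + ((Finset.range k).filter fun g => ((g : ℕ) : ℤ) ∈ x.2).card
  have hl : ∀ k, l (k + 1) = l k + if ((k : ℕ) : ℤ) ∈ x.2 then 1 else 0 := by
    intro k
    simp only [l, Finset.range_add_one, Finset.filter_insert]
    split_ifs with h
    · rw [Finset.card_insert_of_notMem (by simp)]
      omega
    · omega
  have hmono : Monotone l := monotone_nat_of_le_succ fun k => by rw [hl]; omega
  have hinit : ∀ k i, 1 ≤ i → i ≤ l k → ∃ j ≤ k, l j = i := by
    intro k
    induction k with
    | zero =>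
      intro i h1 h2
      have h0 : l 0 = 1 := by simp [l]
      exact ⟨0, le_rfl, by omega⟩
    | succ k ih =>
      intro i h1 h2
      by_cases h3 : i ≤ l k
      · obtain ⟨j, hj, hji⟩ := ih i h1 h3
        exact ⟨j, by omega, hji⟩
      · refine ⟨k + 1, le_rfl, ?_⟩
        have := hl k
        split_ifs at this <;> omega
  let T : Tree n :=
    { graph := G
      isTree := hG.isTree
      nonCrossing := by
        rintro s t u v hst htu huv ⟨hsu, htv⟩
        rw [Fin.lt_def] at hst htu huv
        have hcast : ∀ {v w : Fin (n + 1)}, G.Adj v w →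
            x.1 (v : ℕ) = ((w : ℕ) : ℤ) ∨ x.1 (w : ℕ) = ((v : ℕ) : ℤ) := by
          rintro v w ⟨-, h | h⟩
          · exact Or.inl (by rw [← hpx, h])
          · exact Or.inr (by rw [← hpx, h])
        exact hx.cross (s : ℕ) (t : ℕ) (u : ℕ) (v : ℕ) (by omega) (by omega) (by omega)
          (hcast hsu) (hcast htv)
      label := fun v => l v
      label_pos := fun v => by simp only [l]; omega
      label_mono := fun v w h => hmono h
      label_initial := fun v i h1 h2 => by
        obtain ⟨j, hj, hji⟩ := hinit v i h1 h2
        exact ⟨⟨j, by omega⟩, hji⟩ }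
  have hT : IsParent T.graph p := hG
  refine ⟨T, p, Prod.ext (funext fun z => ?_) (Set.ext fun g => ?_), hT, fun v hv => ?_⟩
  · by_cases hz : 0 ≤ z ∧ z ≤ n
    · obtain ⟨v, rfl⟩ := exists_fin hz.1 hz.2
      rw [code_fst hT, hpx]
    · rw [code_fst_of_not_mem hz, hx.fix z (by omega)]
  · constructor
    · rintro ⟨i, hi, rfl, h⟩
      have h1 : l i < l (i + 1) := h
      rw [hl] at h1
      by_contra hcon
      rw [if_neg hcon] at h1
      omega
    · intro hg
      have := hx.gaps g hg
      refine ⟨g.toNat, by omega, by omega, ?_⟩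
      change l g.toNat < l (g.toNat + 1)
      have hgg : ((g.toNat : ℕ) : ℤ) = g := by omega
      rw [hl, hgg, if_pos hg]
      omega
  · have hlt : ∀ g ∈ x.2, ∀ v w : Fin (n + 1), ((v : ℕ) : ℤ) ≤ g → g < (w : ℕ) → l v < l w := by
      intro g hg v w h1 h2
      obtain ⟨k, rfl⟩ : ∃ k : ℕ, g = k := ⟨g.toNat, by omega⟩
      calc l v ≤ l k := hmono (by omega)
        _ < l (k + 1) := by rw [hl, if_pos hg]; omega
        _ ≤ l w := hmono (by omega)
    have hne := hT.ne_self hv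
    rcases lt_or_gt_of_ne hne with h | h
    · obtain ⟨g, hg, h1, h2⟩ := hx.down (v : ℕ) (by rw [← hpx]; exact_mod_cast h)
      rw [← hpx] at h1
      exact (hlt g hg _ _ h1 h2).ne
    · obtain ⟨g, hg, h1, h2⟩ := hx.up (v : ℕ) (by rw [← hpx]; exact_mod_cast h)
      rw [← hpx] at h2
      exact (hlt g hg _ _ h1 h2).ne'

theorem uuFree_code (h : IsParent T.graph p) :
    UUFree T.code ↔ ∀ v, p (p v) < p v → ¬ p v < v := by
  constructor
  · intro hf v h1 h2
    have := hf ((v : ℕ) : ℤ)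
    rw [code_fst h, code_fst h] at this
    exact this (by exact_mod_cast h1) (by exact_mod_cast h2)
  · intro hp z h1 h2
    by_cases hz : 0 ≤ z ∧ z ≤ n
    · obtain ⟨v, rfl⟩ := exists_fin hz.1 hz.2
      rw [code_fst h] at h1 h2
      rw [code_fst h] at h1
      exact hp v (by exact_mod_cast h1) (by exact_mod_cast h2)
    · rw [code_fst_of_not_mem hz] at h2
      exact lt_irrefl _ h2

theorem ddFree_code (h : IsParent T.graph p) :
    DDFree T.code ↔ ∀ v, p v < p (p v) → ¬ v < p v := by
  constructor
  · intro hf v h1 h2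
    have := hf ((v : ℕ) : ℤ)
    rw [code_fst h, code_fst h] at this
    exact this (by exact_mod_cast h1) (by exact_mod_cast h2)
  · intro hp z h1 h2
    by_cases hz : 0 ≤ z ∧ z ≤ n
    · obtain ⟨v, rfl⟩ := exists_fin hz.1 hz.2
      rw [code_fst h] at h1 h2
      rw [code_fst h] at h1
      exact hp v (by exact_mod_cast h1) (by exact_mod_cast h2)
    · rw [code_fst_of_not_mem hz] at h2
      exact lt_irrefl _ h2

end Tree

theorem ncard_avoiding_uu (n : ℕ) :
    (Avoiding n {[Step.u, Step.u], [Step.h]}).ncard = uuCount n := by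
  rw [uuCount, ← Set.ncard_image_of_injective _ (Tree.code_injective (n := n))]
  congr 1
  ext x
  constructor
  · rintro ⟨T, hT, rfl⟩
    obtain ⟨p, hp⟩ := exists_isParent T.isTree
    rw [Tree.mem_avoiding_uu hp] at hT
    exact ⟨Tree.isCode_code hp hT.1, (Tree.uuFree_code hp).2 hT.2⟩
  · rintro ⟨hx, qx⟩
    obtain ⟨T, p, rfl, hp, hlev⟩ := Tree.exists_code_eq hx
    exact ⟨T, (Tree.mem_avoiding_uu hp).2 ⟨hlev, (Tree.uuFree_code hp).1 qx⟩, rfl⟩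

theorem ncard_avoiding_dd (n : ℕ) :
    (Avoiding n {[Step.d, Step.d], [Step.h]}).ncard = ddCount n := by
  rw [ddCount, ← Set.ncard_image_of_injective _ (Tree.code_injective (n := n))]
  congr 1
  ext x
  constructor
  · rintro ⟨T, hT, rfl⟩
    obtain ⟨p, hp⟩ := exists_isParent T.isTree
    rw [Tree.mem_avoiding_dd hp] at hT
    exact ⟨Tree.isCode_code hp hT.1, (Tree.ddFree_code hp).2 hT.2⟩
  · rintro ⟨hx, qx⟩
    obtain ⟨T, p, rfl, hp, hlev⟩ := Tree.exists_code_eq hx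
    exact ⟨T, (Tree.mem_avoiding_dd hp).2 ⟨hlev, (Tree.ddFree_code hp).1 qx⟩, rfl⟩

end GNC

theorem mainTheorem6 :
    (∀ n : ℕ,
      (GNC.Avoiding (n + 2) {[GNC.Step.u, GNC.Step.u], [GNC.Step.h]}).ncard =
        ∑ i ∈ Finset.range (n + 1), n.choose i * 2 ^ (i + 2) * catalan (i + 1)) ∧
    (∀ n : ℕ,
      ((GNC.Avoiding n {[GNC.Step.d, GNC.Step.d], [GNC.Step.h]}).ncard : ℤ) =
        ∑ j ∈ Finset.range (n + 1),
          (-1 : ℤ) ^ j * ((2 * n - j).choose j : ℤ) * 3 ^ j * 4 ^ (n - j) *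
            (catalan (n - j) : ℤ)) := by
  have h := GNC.coeff_of_recurrence GNC.uuCount_zero GNC.ddCount_zero GNC.uuCount_succ
    GNC.ddCount_succ
  refine ⟨fun n => ?_, fun n => ?_⟩
  · rw [GNC.ncard_avoiding_uu]
    exact h.1 n
  · rw [GNC.ncard_avoiding_dd]
    exact h.2 n
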